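/- **Definitions.** Write $q=e^{2\pi i\tau}$ with $\operatorname{Im}\tau>0$, and $q^{c}=e^{2\pi i c\tau}$. For a positive integer $m$ and $s\in\frac12\mathbb Z$ put $$\Theta_{j,m}(\tau,z)=\sum_{n\in\mathbb Z+\frac{j}{2m}}q^{mn^2}e^{2\pi i mnz},\qquad \Phi_1^{[m;s]}(\tau,z_1,z_2)=\sum_{j\in\mathbb Z}\frac{e^{2\pi i mj(z_1+z_2)+2\pi i sz_1}\,q^{j^2m+js}}{1-e^{2\pi i z_1}q^j},$$ $$\Phi^{[m;s]}(\tau,z_1,z_2,t)=e^{2\pi i mt}\bigl(\Phi_1^{[m;s]}(\tau,z_1,z_2)-\Phi_1^{[m;s]}(\tau,-z_2,-z_1)\bigr).$$ Let $E(x)=2\int_0^xe^{-\pi u^2}\,du$ and, for $j\in\frac12\mathbb Z$, $$R_{j;m}(\tau,v)=\sum_{n\equiv j\bmod 2m}\Bigl(\operatorname{sgn}\bigl(n-\tfrac12-j+2m\bigr)-E\Bigl(\bigl(n-2m\tfrac{\operatorname{Im}v}{\operatorname{Im}\tau}\bigr)\sqrt{\tfrac{\operatorname{Im}\tau}{m}}\Bigr)\Bigr)e^{-\frac{\pi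 i n^2}{2m}\tau+2\pi i nv}.$$ Let $$\Phi^{[m;s]}_{\mathrm{add}}(\tau,z_1,z_2,t)=\tfrac12e^{2\pi i mt}\sum_{j=s}^{s+2m-1}R_{j;m}\bigl(\tau,\tfrac{z_1-z_2}{2}\bigr)\,(\Theta_{-j,m}-\Theta_{j,m})(\tau,z_1+z_2),\qquad \tilde\Phi^{[m;s]}=\Phi^{[m;s]}+\Phi^{[m;s]}_{\mathrm{add}}.$$ For a positive integer $M$, $\epsilon,\epsilon'\in\{0,\frac12\}$ and $a,b\in\epsilon'+\mathbb Z$, let $$\tilde\Psi^{[M,m,s;\epsilon]}_{a,b;\epsilon'}(\tau,z_1,z_2,t)=q^{\frac{mab}{M}}e^{\frac{2\pi i m}{M}(bz_1+az_2)}\,\tilde\Phi^{[m;s]}\bigl(M\tau,\,z_1+a\tau+\epsilon,\,z_2+b\tau+\epsilon,\,\tfrac tM\bigr).$$ Let $M$ be a positive odd integer and $n$ a positive integer coprime to $M$. Let $\epsilon,\epsilon'\in\{0,\frac12\}$, considered modulo $\mathbb Z$, let $j,k\in\epsilon'+\mathbb Z$, and let $\sigma,\sigma'\in\{0,\frac12\}$.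 Put $$f^{[M;n;\epsilon](\sigma,\sigma')}_{j,k;\epsilon'}(\tau,z)=q^{-\frac{n}{4M}\sigma'^2}\,\tilde\Psi^{[M,n,0;\epsilon]}_{j,k;\epsilon'}\Bigl(\tau,\tfrac{z+\sigma+\sigma'\tau}{2},\tfrac{z-\sigma-\sigma'\tau}{2},0\Bigr).$$ This function is defined at $(\tau,z)$ unless $\frac{z+\sigma+\sigma'\tau}{2}+j\tau+\epsilon$ or $\frac{z-\sigma-\sigma'\tau}{2}+k\tau+\epsilon$ lies in $\mathbb Z+M\tau\mathbb Z$ (its poles). **Proposition 4.6.** For all $\tau,z\in\mathbb C$ with $\operatorname{Im}\tau>0$, each of the following identities holds whenever all the functions $f$ on its right-hand side are defined at $(\tau,z)$. (a) For any choice of representatives of the classes in $(\epsilon+\mathbb Z/M\mathbb Z)^2$, $$f^{[M;n;\epsilon](\sigma,\sigma')}_{j,k;\epsilon'}\Bigl(-\frac1\tau,\frac z\tau\Bigr)=\frac{\tau}{M}\,e^{\frac{\pi i n}{2M\tau}z^2}e^{\frac{\pi i n}{M}\sigma\sigma'}\sum_{(a,b)\in(\epsilon+\mathbb Z/M\mathbb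 Z)^2}e^{-\frac{2\pi i n}{M}(ak+bj)+\frac{2\pi i n}{M}\sigma'(a-b)}\,f^{[M;n;\epsilon'+\sigma'](\sigma',\sigma)}_{a,b;\epsilon}(\tau,z).$$ (b) $$f^{[M;n;\epsilon](\sigma,0)}_{j,k;\epsilon'}(\tau+1,z)=e^{\frac{2\pi i n}{M}jk}\,f^{[M;n;\epsilon+\epsilon'](\sigma,0)}_{j,k;\epsilon'}(\tau,z),$$ $$f^{[M;n;\epsilon](\sigma,\frac12)}_{j,k;\epsilon'}(\tau+1,z)=e^{\frac{2\pi i n}{M}(jk-\frac1{16})}\,e^{\frac{2\pi i n\sigma}{M}(k-j)}\,f^{[M;n;\epsilon+\epsilon'-\sigma](\frac12-\sigma,\frac12)}_{j,k;\epsilon'}(\tau,z).$$ -/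

import Mathlib

namespace KacWakimoto

noncomputable section

/-- `e2 x = e^{2πi x}`; in particular `q ^ c` is `e2 (c * τ)`, where `q = e^{2πi τ}`. -/
def e2 (x : ℂ) : ℂ := Complex.exp (2 * Real.pi * Complex.I * x)

/-- An element of `½ℤ / ℤ = {0, ½}` is coded by an element of `ZMod 2`, and `half` returns its
representative: `half 0 = 0`, `half 1 = 1/2`. Addition in `ZMod 2` is addition modulo `ℤ`. -/
def half (x : ZMod 2) : ℝ := (x.val : ℝ) / 2

/-- Degree `m` theta function `Θ_{j,m}(τ,z,t) = e^{2πimt} ∑_{n ∈ ℤ + j/2m} q^{m n²} e^{2πi m n z}`. -/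
def Theta (j : ℝ) (m : ℕ) (τ z t : ℂ) : ℂ :=
  e2 (m * t) * ∑' k : ℤ,
    e2 (m * ((k : ℂ) + j / (2 * m)) ^ 2 * τ) * e2 (m * ((k : ℂ) + j / (2 * m)) * z)

/-- The mock theta function `Φ₁^{[m;s]}(τ,z₁,z₂)`. -/
def Phi₁ (m : ℕ) (s : ℝ) (τ z₁ z₂ : ℂ) : ℂ :=
  ∑' j : ℤ, e2 (m * j * (z₁ + z₂) + s * z₁) * e2 (((j : ℂ) ^ 2 * m + j * s) * τ) /
    (1 - e2 z₁ * e2 (j * τ))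

/-- `Φ^{[m;s]}(τ,z₁,z₂,t)`. -/
def Phi (m : ℕ) (s : ℝ) (τ z₁ z₂ t : ℂ) : ℂ :=
  e2 (m * t) * (Phi₁ m s τ z₁ z₂ - Phi₁ m s τ (-z₂) (-z₁))

/-- `E(x) = 2 ∫₀ˣ e^{-πu²} du`. -/
def E (x : ℝ) : ℝ := 2 * ∫ u in (0 : ℝ)..x, Real.exp (-Real.pi * u ^ 2)

/-- The term of `R_{j;m}(τ,v)` attached to the summation index `n`. -/
def RTerm (j : ℝ) (m : ℕ) (τ v : ℂ) (n : ℝ) : ℂ :=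
  ((Real.sign (n - 1 / 2 - j + 2 * m) -
      E ((n - 2 * m * (v.im / τ.im)) * Real.sqrt (τ.im / m)) : ℝ) : ℂ) *
    Complex.exp (-(Real.pi * Complex.I * (n : ℂ) ^ 2 / (2 * m)) * τ +
      2 * Real.pi * Complex.I * n * v)

/-- `R_{j;m}(τ,v)`: the sum over all `n ≡ j mod 2m`. -/
def R (j : ℝ) (m : ℕ) (τ v : ℂ) : ℂ := ∑' k : ℤ, RTerm j m τ v (j + 2 * m * k)

/-- The real analytic correction `Φ_add^{[m;s]}(τ,z₁,z₂,t)`; the summation index is `j = s + i`,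
`0 ≤ i ≤ 2m - 1`. -/
def PhiAdd (m : ℕ) (s : ℝ) (τ z₁ z₂ t : ℂ) : ℂ :=
  1 / 2 * e2 (m * t) * ∑ i ∈ Finset.range (2 * m),
    R (s + i) m τ ((z₁ - z₂) / 2) *
      (Theta (-(s + i)) m τ (z₁ + z₂) 0 - Theta (s + i) m τ (z₁ + z₂) 0)

/-- The modification of `Φ^{[m;s]}`. -/
def PhiTilde (m : ℕ) (s : ℝ) (τ z₁ z₂ t : ℂ) : ℂ :=
  Phi m s τ z₁ z₂ t + PhiAdd m s τ z₁ z₂ t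

/-- The modification of `Ψ^{[M,m,s;ε]}_{a,b;ε'}`. The index `ε'` only records that
`a, b ∈ ε' + ℤ`, so it is not an argument. -/
def PsiTilde (M m : ℕ) (s : ℝ) (ε : ZMod 2) (a b : ℝ) (τ z₁ z₂ t : ℂ) : ℂ :=
  e2 (m * a * b / M * τ) * e2 (m / M * (b * z₁ + a * z₂)) *
    PhiTilde m s (M * τ) (z₁ + a * τ + half ε) (z₂ + b * τ + half ε) (t / M)

/-- `f^{[M;n;ε](σ,σ')}_{j,k;ε'}(τ,z)`, for `j, k ∈ ε' + ℤ`. -/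
def f (M n : ℕ) (ε σ σ' : ZMod 2) (j k : ℝ) (τ z : ℂ) : ℂ :=
  e2 (-(n / (4 * M)) * (half σ' : ℂ) ^ 2 * τ) *
    PsiTilde M n 0 ε j k τ ((z + half σ + half σ' * τ) / 2) ((z - half σ - half σ' * τ) / 2) 0

/-- `(z₁, z₂)` is not a pole of `Φ^{[m;s]}(τ, ·, ·, t)`, that is, neither `z₁` nor `z₂` lies
in the lattice `ℤ + ℤτ`. -/
def PhiRegular (τ z₁ z₂ : ℂ) : Prop := ∀ p l : ℤ, z₁ ≠ p + l * τ ∧ z₂ ≠ p + l * τ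

/-- The point `(τ,z)` is not a pole of `f^{[M;n;ε](σ,σ')}_{j,k;ε'}`. -/
def FRegular (M : ℕ) (ε σ σ' : ZMod 2) (j k : ℝ) (τ z : ℂ) : Prop :=
  PhiRegular (M * τ) ((z + half σ + half σ' * τ) / 2 + j * τ + half ε)
    ((z - half σ - half σ' * τ) / 2 + k * τ + half ε)

end

end KacWakimoto

namespace KacWakimoto

/-! ### The exponential `e2` -/

/-! The completed function is a difference of two copies of a Gaussian-damped Kronecker–Eisenstein
series, `appellCompletion`: an absolutely convergent sum over w = z₁ + aτ + c of a Gaussian in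
|w|²/Im τ times an exponential, divided by w. For such a series modularity is visible. Under τ ↦ τ +
1 and τ ↦ -1/τ the lattice is permuted or rescaled, and only elementary exponential factors appear.

The work lies in the identification `PhiTilde_eq`. Fix a and sum over c. Since e2(w) is unchanged by
w ↦ w + 1, the reciprocal 1/w is a constant times the integral of e2(tw) over t in [0,1]. Poisson
summation in c followed by integration in t gives differences of values of `E` at consecutive
points, and summation by parts turns these into 1/(1 - e2 w) minus half a series in sgn - E
(`tsum_rowTerm`). Summed over a, the first part is `Phi₁`. The second, grouped by residues modulo
2m, is the sum of the products `R` · `Theta`.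

For the inversion of `f` one applies τ ↦ -1/τ to `PhiTilde` at τ/M and then a distribution relation
(`PhiTilde_div_nat`). In the lattice sum at τ/M, written over ℤτ + Mℤ, the condition M ∣ c is
detected by averaging over the M-th roots of unity, which works because n is coprime to M, and a is
split into classes modulo M. This gives M² terms at Mτ. The remaining claims follow by comparing
exponents. -/

theorem e2_add (x y : ℂ) : e2 (x + y) = e2 x * e2 y := by
  simp only [e2, mul_add, Complex.exp_add]

theorem e2_zero : e2 0 = 1 := by simp [e2]

theorem e2_intCast (n : ℤ) : e2 n = 1 :=
  Complex.exp_eq_one_iff.2 ⟨n, by ring⟩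

theorem e2_eq_one_iff (x : ℂ) : e2 x = 1 ↔ ∃ n : ℤ, x = n := by
  constructor
  · intro h
    obtain ⟨n, hn⟩ := Complex.exp_eq_one_iff.1 h
    refine ⟨n, mul_left_cancel₀ Complex.two_pi_I_ne_zero ?_⟩
    rw [hn]; ring
  · rintro ⟨n, rfl⟩
    exact e2_intCast n

theorem e2_eq_e2_of_sub_int {x y : ℂ} (n : ℤ) (h : x - y = n) : e2 x = e2 y := by
  have : x = y + n := by rw [← h]; ring
  rw [this, e2_add, e2_intCast, mul_one]

theorem norm_e2 (x : ℂ) : ‖e2 x‖ = Real.exp (-(2 * Real.pi * x.im)) := by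
  rw [e2, Complex.norm_exp]
  congr 1
  simp

theorem continuous_e2 : Continuous e2 := by
  unfold e2; fun_prop

/-! ### Summability of Gaussians over `ℤ` and `ℤ²` -/

theorem summable_exp_quadratic_int {p : ℝ} (hp : 0 < p) (b d : ℝ) :
    Summable fun n : ℤ ↦ Real.exp (-(p * n ^ 2) + b * n + d) := by
  have h := ((summable_jacobiTheta₂_term_iff (-(b / (2 * Real.pi)) * Complex.I)
    ((p / Real.pi : ℝ) * Complex.I)).2 (by simpa using by positivity)).norm.mul_right (Real.exp d)
  refine h.congr fun n ↦ ?_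
  rw [norm_jacobiTheta₂_term, ← Real.exp_add]
  congr 1
  have h1 : ((p / Real.pi : ℝ) * Complex.I).im = p / Real.pi := by simp
  have h2 : (-(b / (2 * Real.pi)) * Complex.I : ℂ).im = -(b / (2 * Real.pi)) := by
    rw [show (-(b / (2 * Real.pi)) * Complex.I : ℂ) =
      ((-(b / (2 * Real.pi)) : ℝ) : ℂ) * Complex.I by push_cast; ring, Complex.mul_I_im,
      Complex.ofReal_re]
  rw [h1, h2]
  field_simp
  ring

/-- With κ = det/trace, trace · (form) - det · (x² + y²) is the sum of squares (px + qy)² + (qx +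
ry)². -/
theorem exists_quadratic_form_bound {p q r : ℝ} (hp : 0 < p) (hD : q ^ 2 < p * r) :
    ∃ κ > 0, ∀ x y : ℝ, κ * (x ^ 2 + y ^ 2) ≤ p * x ^ 2 + 2 * q * x * y + r * y ^ 2 := by
  have hr : 0 < r := by
    by_contra! h
    nlinarith [sq_nonneg q]
  refine ⟨(p * r - q ^ 2) / (p + r), by apply div_pos <;> linarith, fun x y ↦ ?_⟩
  have hpr : 0 < p + r := by linarith
  rw [div_mul_eq_mul_div, div_le_iff₀ hpr]
  nlinarith [sq_nonneg (p * x + q * y), sq_nonneg (q * x + r * y)]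

theorem summable_exp_quadratic_int_sq {p q r : ℝ} (hp : 0 < p) (hD : q ^ 2 < p * r)
    (b₁ b₂ d : ℝ) :
    Summable fun x : ℤ × ℤ ↦ Real.exp (-(p * x.1 ^ 2 + 2 * q * x.1 * x.2 + r * x.2 ^ 2)
      + b₁ * x.1 + b₂ * x.2 + d) := by
  obtain ⟨κ, hκ, h⟩ := exists_quadratic_form_bound hp hD
  have hs := (summable_exp_quadratic_int hκ b₁ d).mul_of_nonneg
    (summable_exp_quadratic_int hκ b₂ 0) (fun _ ↦ (Real.exp_pos _).le)
    (fun _ ↦ (Real.exp_pos _).le)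
  refine Summable.of_nonneg_of_le (fun _ ↦ (Real.exp_pos _).le) (fun x ↦ ?_) hs
  rw [← Real.exp_add]
  apply Real.exp_le_exp.2
  have := h x.1 x.2
  linarith

/-! ### The error function `E` -/

theorem continuous_gaussian : Continuous fun u : ℝ ↦ Real.exp (-Real.pi * u ^ 2) := by fun_prop

theorem E_sub_E (x y : ℝ) : E y - E x = 2 * ∫ u in x..y, Real.exp (-Real.pi * u ^ 2) := by
  rw [E, E, ← mul_sub, intervalIntegral.integral_interval_sub_left] <;>
  exact continuous_gaussian.intervalIntegrable _ _

theorem E_neg (x : ℝ) : E (-x) = -E x := by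
  have := intervalIntegral.integral_comp_neg (a := 0) (b := x)
    (fun u : ℝ ↦ Real.exp (-Real.pi * u ^ 2))
  simp only [neg_zero, neg_sq] at this
  rw [E, E, this, intervalIntegral.integral_symm]
  ring

theorem integrable_gaussian_pi : MeasureTheory.Integrable
    (fun u : ℝ ↦ Real.exp (-Real.pi * u ^ 2)) :=
  integrable_exp_neg_mul_sq Real.pi_pos

/-- The tail integral is translated to a fixed half-line, so that Gaussians for different x can be
compared pointwise. -/
theorem one_sub_E (x : ℝ) :
    1 - E x = 2 * ∫ u in Set.Ioi (0 : ℝ), Real.exp (-Real.pi * (u + x) ^ 2) := by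
  have h0 : ∫ u in Set.Ioi (0 : ℝ), Real.exp (-Real.pi * u ^ 2) = 1 / 2 := by
    rw [integral_gaussian_Ioi, div_self Real.pi_ne_zero, Real.sqrt_one]
  have h1 : (∫ u in Set.Ioi (0 : ℝ), Real.exp (-Real.pi * (u + x) ^ 2)) =
      ∫ u in Set.Ioi x, Real.exp (-Real.pi * u ^ 2) := by
    have := (MeasureTheory.measurePreserving_add_right MeasureTheory.volume
      x).setIntegral_preimage_emb (measurableEmbedding_addRight x)
      (fun u : ℝ ↦ Real.exp (-Real.pi * u ^ 2)) (Set.Ioi x)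
    rwa [Set.preimage_add_const_Ioi, sub_self] at this
  have h2 := intervalIntegral.integral_Ioi_sub_Ioi' (a := 0) (b := x)
    (f := fun u : ℝ ↦ Real.exp (-Real.pi * u ^ 2)) (μ := MeasureTheory.volume)
    integrable_gaussian_pi.integrableOn integrable_gaussian_pi.integrableOn
  rw [h1, E, ← h2, h0]
  ring

theorem abs_one_sub_E_le {x : ℝ} (hx : 0 ≤ x) : |1 - E x| ≤ Real.exp (-Real.pi * x ^ 2) := by
  have h0 : ∫ u in Set.Ioi (0 : ℝ), Real.exp (-Real.pi * u ^ 2) = 1 / 2 := by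
    rw [integral_gaussian_Ioi, div_self Real.pi_ne_zero, Real.sqrt_one]
  have hn : 0 ≤ ∫ u in Set.Ioi (0 : ℝ), Real.exp (-Real.pi * (u + x) ^ 2) :=
    MeasureTheory.setIntegral_nonneg measurableSet_Ioi fun _ _ ↦ (Real.exp_pos _).le
  rw [one_sub_E, abs_of_nonneg (by positivity)]
  have hle : ∫ u in Set.Ioi (0 : ℝ), Real.exp (-Real.pi * (u + x) ^ 2) ≤
      ∫ u in Set.Ioi (0 : ℝ), Real.exp (-Real.pi * x ^ 2) * Real.exp (-Real.pi * u ^ 2) := by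
    refine MeasureTheory.setIntegral_mono_on ?_ ?_ measurableSet_Ioi fun u hu ↦ ?_
    · exact (integrable_gaussian_pi.comp_add_right x).integrableOn
    · exact (integrable_gaussian_pi.const_mul _).integrableOn
    · rw [← Real.exp_add]
      apply Real.exp_le_exp.2
      have : 0 ≤ Real.pi * (u * x) := mul_nonneg Real.pi_pos.le (mul_nonneg (le_of_lt hu) hx)
      nlinarith
  rw [MeasureTheory.integral_const_mul, h0] at hle
  linarith

theorem abs_E_le_one (x : ℝ) : |E x| ≤ 1 := by
  have key : ∀ x : ℝ, 0 ≤ x → |E x| ≤ 1 := by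
    intro x hx
    have h1 := abs_le.1 (abs_one_sub_E_le hx)
    have h2 : Real.exp (-Real.pi * x ^ 2) ≤ 1 := by
      apply Real.exp_le_one_iff.2
      nlinarith [Real.pi_pos, sq_nonneg x]
    have h3 : 0 ≤ E x := by
      rw [E]
      have : 0 ≤ ∫ u in (0 : ℝ)..x, Real.exp (-Real.pi * u ^ 2) :=
        intervalIntegral.integral_nonneg hx fun _ _ ↦ (Real.exp_pos _).le
      positivity
    have h4 : 0 ≤ 1 - E x := by
      rw [one_sub_E]
      have := MeasureTheory.setIntegral_nonneg (μ := MeasureTheory.volume) measurableSet_Ioi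
        fun u (_ : u ∈ Set.Ioi (0 : ℝ)) ↦ (Real.exp_pos (-Real.pi * (u + x) ^ 2)).le
      positivity
    rw [abs_le]; constructor <;> linarith
  rcases le_total 0 x with h | h
  · exact key x h
  · have := key (-x) (by linarith)
    rwa [E_neg, abs_neg] at this

/-- The sign of an integer, with the convention that `0` is positive. -/
noncomputable def intSign (n : ℤ) : ℝ := if 0 ≤ n then 1 else -1

/-- If n and n + δ have the same sign, this is the Gaussian tail bound for 1 - E. Otherwise |n + δ|
≤ |δ|, and the factor exp(π(δr)²) absorbs the trivial bound 2. -/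
theorem abs_intSign_sub_E_le (r δ : ℝ) (hr : 0 < r) (n : ℤ) :
    |intSign n - E ((n + δ) * r)| ≤
      2 * Real.exp (Real.pi * (δ * r) ^ 2) * Real.exp (-Real.pi * ((n + δ) * r) ^ 2) := by
  have hpos := Real.pi_pos
  have hE := abs_le.1 (abs_E_le_one ((n + δ) * r))
  have hbig : 1 ≤ Real.exp (Real.pi * (δ * r) ^ 2) := Real.one_le_exp (by positivity)
  have hG := Real.exp_pos (-Real.pi * ((n + δ) * r) ^ 2)
  have hsmall : ((n + δ) * r) ^ 2 ≤ (δ * r) ^ 2 → |intSign n - E ((n + δ) * r)| ≤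
      2 * Real.exp (Real.pi * (δ * r) ^ 2) * Real.exp (-Real.pi * ((n + δ) * r) ^ 2) := by
    intro h
    rw [mul_assoc, ← Real.exp_add]
    have h1 : 1 ≤ Real.exp (Real.pi * (δ * r) ^ 2 + -Real.pi * ((n + δ) * r) ^ 2) :=
      Real.one_le_exp (by nlinarith)
    have h2 : |intSign n - E ((n + δ) * r)| ≤ 2 := by
      unfold intSign
      split_ifs <;> rw [abs_le] <;> constructor <;> linarith
    linarith
  have htriv : Real.exp (-Real.pi * ((n + δ) * r) ^ 2) ≤
      2 * Real.exp (Real.pi * (δ * r) ^ 2) * Real.exp (-Real.pi * ((n + δ) * r) ^ 2) := by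
    nlinarith
  rcases le_or_gt 0 n with hn | hn
  · have hn' : (0 : ℝ) ≤ n := by exact_mod_cast hn
    rcases le_or_gt 0 ((n + δ) * r) with hx | hx
    · simp only [intSign, hn, if_true]
      exact (abs_one_sub_E_le hx).trans htriv
    · apply hsmall
      have : δ * r ≤ (n + δ) * r := by nlinarith
      nlinarith
  · have hn' : (n : ℝ) < 0 := by exact_mod_cast hn
    rcases le_or_gt 0 (-((n + δ) * r)) with hx | hx
    · simp only [intSign, not_le.2 hn, if_false]
      have := abs_one_sub_E_le hx
      rw [E_neg, neg_sq] at this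
      rw [show (-1 - E ((n + δ) * r)) = -(1 - -E ((n + δ) * r)) by ring, abs_neg]
      exact this.trans htriv
    · apply hsmall
      have : (n + δ) * r ≤ δ * r := by nlinarith
      nlinarith

/-! ### Poisson summation for a twisted Gaussian -/

theorem gaussian_term_eq_jacobiTheta₂_term (s r x η : ℝ) (hr : 0 < r) (c : ℤ) :
    e2 (s * ((x + η * Complex.I) + c)) *
      Real.exp (-Real.pi * ((x + c) ^ 2 + η ^ 2) / r ^ 2) =
    e2 (s * (x + η * Complex.I)) * Real.exp (-Real.pi * (x ^ 2 + η ^ 2) / r ^ 2) *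
      jacobiTheta₂_term c (s + Complex.I * (x / r ^ 2)) (Complex.I * (1 / r ^ 2)) := by
  have hr' : (r : ℂ) ≠ 0 := by exact_mod_cast hr.ne'
  simp only [e2, jacobiTheta₂_term, Complex.ofReal_exp, ← Complex.exp_add]
  congr 1
  push_cast
  field_simp
  linear_combination (-(2 * x * c + c ^ 2) : ℂ) * Complex.I_sq

theorem gaussian_dual_term_eq_jacobiTheta₂_term (s r x η : ℝ) (hr : 0 < r) (k : ℤ) :
    e2 (k * (x + η * Complex.I)) *
      Real.exp (-Real.pi * ((s - k + η / r ^ 2) * r) ^ 2) =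
    e2 (s * (x + η * Complex.I)) * Real.exp (-Real.pi * (x ^ 2 + η ^ 2) / r ^ 2) *
      (Complex.exp (-Real.pi * Complex.I * (s + Complex.I * (x / r ^ 2)) ^ 2 /
        (Complex.I * (1 / r ^ 2))) *
      jacobiTheta₂_term k ((s + Complex.I * (x / r ^ 2)) / (Complex.I * (1 / r ^ 2)))
        (-1 / (Complex.I * (1 / r ^ 2)))) := by
  have hr' : (r : ℂ) ≠ 0 := by exact_mod_cast hr.ne'
  have h1 : (s + Complex.I * (x / r ^ 2) : ℂ) / (Complex.I * (1 / r ^ 2)) =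
      x - Complex.I * s * r ^ 2 := by
    field_simp
    linear_combination (r ^ 2 * s : ℂ) * Complex.I_sq
  have h2 : (-1 : ℂ) / (Complex.I * (1 / r ^ 2)) = Complex.I * r ^ 2 := by
    field_simp
    linear_combination (-1 : ℂ) * Complex.I_sq
  have h3 : -Real.pi * Complex.I * (s + Complex.I * (x / r ^ 2)) ^ 2 /
        (Complex.I * (1 / r ^ 2)) = -Real.pi * r ^ 2 * (s + Complex.I * (x / r ^ 2)) ^ 2 := by
    field_simp
  rw [h1, h2, h3]
  simp only [e2, jacobiTheta₂_term, Complex.ofReal_exp, ← Complex.exp_add]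
  congr 1
  push_cast
  field_simp
  linear_combination (2 * k * η * r ^ 2 - 2 * s * η * r ^ 2 + x ^ 2 + 2 * k * s * r ^ 4 -
    k ^ 2 * r ^ 4 : ℂ) * Complex.I_sq

/-- Poisson summation, in the guise of the functional equation of `jacobiTheta₂` at the purely
imaginary point i/r². The twist s and the real part of w together form the elliptic variable. -/
theorem tsum_gaussian_eq_dual (s r : ℝ) (hr : 0 < r) (w : ℂ) :
    ∑' c : ℤ, e2 (s * (w + c)) * Real.exp (-Real.pi * Complex.normSq (w + c) / r ^ 2) =
      r * ∑' k : ℤ, e2 (k * w) * Real.exp (-Real.pi * ((s - k + w.im / r ^ 2) * r) ^ 2) := by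
  obtain ⟨x, η⟩ := w
  have h1 : ∀ c : ℤ, Complex.normSq (x + η * Complex.I + c) = (x + c) ^ 2 + η ^ 2 := by
    intro c
    simp [Complex.normSq_apply]; ring
  simp only [Complex.mk_eq_add_mul_I, h1, gaussian_term_eq_jacobiTheta₂_term s r x η hr, tsum_mul_left]
  simp only [gaussian_dual_term_eq_jacobiTheta₂_term s r x η hr, tsum_mul_left]
  have h3 := jacobiTheta₂_functional_equation (s + Complex.I * (x / r ^ 2))
    (Complex.I * (1 / r ^ 2))
  have h4 : 1 / (-Complex.I * (Complex.I * (1 / r ^ 2))) ^ (1 / 2 : ℂ) = (r : ℂ) := by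
    rw [show (-Complex.I * (Complex.I * (1 / r ^ 2)) : ℂ) = (((r ^ 2)⁻¹ : ℝ) : ℂ) by
      push_cast
      linear_combination (-(1 / r ^ 2) : ℂ) * Complex.I_sq]
    rw [show (1 / 2 : ℂ) = ((1 / 2 : ℝ) : ℂ) by push_cast; rfl,
      ← Complex.ofReal_cpow (by positivity), ← Real.sqrt_eq_rpow, Real.sqrt_inv,
      Real.sqrt_sq hr.le]
    push_cast
    simp
  rw [h4] at h3
  unfold jacobiTheta₂ at h3
  rw [h3]
  ring

theorem summable_gaussian (r : ℝ) (hr : 0 < r) (w : ℂ) :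
    Summable fun c : ℤ ↦ Real.exp (-Real.pi * Complex.normSq (w + c) / r ^ 2) := by
  refine (summable_exp_quadratic_int (p := Real.pi / r ^ 2) (by positivity)
    (-(2 * Real.pi * w.re / r ^ 2)) (-(Real.pi * (w.re ^ 2 + w.im ^ 2) / r ^ 2))).congr fun c ↦ ?_
  congr 1
  simp only [Complex.normSq_apply, Complex.add_re, Complex.add_im, Complex.intCast_re,
    Complex.intCast_im]
  ring

/-! ### One row of the lattice sum -/

/-- The summand attached to `c` in one row of the lattice sum. -/
noncomputable def rowTerm (β r : ℝ) (w : ℂ) (c : ℤ) : ℂ :=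
  e2 (-β * (w + c)) * Real.exp (-Real.pi * Complex.normSq (w + c) / r ^ 2) / (w + c)

/-- The factor 1 - e2(u) depends only on u modulo ℤ, so it is constant along a row and can be taken
out of the sum over c. -/
theorem inv_eq_integral_e2 {u : ℂ} (hu : e2 u ≠ 1) :
    -1 / (2 * Real.pi * Complex.I) / u = 1 / (1 - e2 u) * ∫ t in (0 : ℝ)..1, e2 (t * u) := by
  have hu0 : u ≠ 0 := by rintro rfl; exact hu e2_zero
  have h1 : (1 - e2 u) ≠ 0 := sub_ne_zero.2 (Ne.symm hu)
  have hpi : (Real.pi : ℂ) ≠ 0 := by exact_mod_cast Real.pi_ne_zero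
  have hc : 2 * Real.pi * Complex.I * u ≠ 0 := mul_ne_zero Complex.two_pi_I_ne_zero hu0
  have h2 : ∫ t in (0 : ℝ)..1, e2 (t * u) = (e2 u - 1) / (2 * Real.pi * Complex.I * u) := by
    have := integral_exp_mul_complex (a := 0) (b := 1) hc
    simp only [Complex.ofReal_one, mul_one, Complex.ofReal_zero, mul_zero, Complex.exp_zero] at this
    rw [e2, ← this]
    refine intervalIntegral.integral_congr fun t _ ↦ ?_
    simp only [e2]
    congr 1; ring
  rw [h2]
  field_simp
  ring

theorem rowTerm_eq_integral (β r : ℝ) {w : ℂ} (hw : e2 w ≠ 1) (c : ℤ) :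
    -1 / (2 * Real.pi * Complex.I) * rowTerm β r w c = 1 / (1 - e2 w) *
      ∫ t in (0 : ℝ)..1, e2 ((t - β : ℝ) * (w + c)) *
        Real.exp (-Real.pi * Complex.normSq (w + c) / r ^ 2) := by
  have hc : e2 (w + c) = e2 w := by rw [e2_add, e2_intCast, mul_one]
  have h := inv_eq_integral_e2 (u := w + c) (by rwa [hc])
  have h2 : ∀ t : ℝ, e2 ((t - β : ℝ) * (w + c)) *
        Real.exp (-Real.pi * Complex.normSq (w + c) / r ^ 2) = e2 (t * (w + c)) *
        (e2 (-β * (w + c)) * Real.exp (-Real.pi * Complex.normSq (w + c) / r ^ 2)) := by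
    intro t
    rw [← mul_assoc, ← e2_add]
    congr 3
    push_cast; ring
  simp only [h2]
  rw [intervalIntegral.integral_mul_const, ← mul_assoc, ← hc, ← h, rowTerm]
  ring

/-- The factor r from Poisson summation is the Jacobian of the substitution carrying [0,1] to an
interval of length r. Oddness of `E` then orders the two endpoint values. -/
theorem integral_gaussian_dual_term (β r : ℝ) (w : ℂ) (k : ℤ) :
    ∫ t in (0 : ℝ)..1, r * (e2 (k * w) *
      (Real.exp (-Real.pi * (((t - β) - k + w.im / r ^ 2) * r) ^ 2) : ℂ)) =
    e2 (k * w) * ((1 / 2 * (E ((k + (β - w.im / r ^ 2)) * r) -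
      E ((k - 1 + (β - w.im / r ^ 2)) * r)) : ℝ) : ℂ) := by
  have h1 := intervalIntegral.mul_integral_comp_mul_add (a := 0) (b := 1)
    (f := fun u : ℝ ↦ Real.exp (-Real.pi * u ^ 2)) r (-(k + (β - w.im / r ^ 2)) * r)
  have h2 := E_sub_E (r * 0 + -(k + (β - w.im / r ^ 2)) * r)
    (r * 1 + -(k + (β - w.im / r ^ 2)) * r)
  rw [← h1] at h2
  have h3 : (k + (β - w.im / r ^ 2)) * r = -(r * 0 + -(k + (β - w.im / r ^ 2)) * r) := by ring
  have h4 : (k - 1 + (β - w.im / r ^ 2)) * r = -(r * 1 + -(k + (β - w.im / r ^ 2)) * r) := by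
    ring
  rw [h3, h4, E_neg, E_neg, neg_sub_neg, h2]
  have h5 : ∀ t : ℝ, (r : ℂ) * (e2 (k * w) *
      (Real.exp (-Real.pi * (((t - β) - k + w.im / r ^ 2) * r) ^ 2) : ℂ)) = e2 (k * w) * (r *
      ((Real.exp (-Real.pi * (r * t + -(k + (β - w.im / r ^ 2)) * r) ^ 2) : ℝ) : ℂ)) := by
    intro t
    rw [show ((t - β) - k + w.im / r ^ 2) * r = r * t + -(k + (β - w.im / r ^ 2)) * r by ring]
    ring
  simp only [h5]
  rw [intervalIntegral.integral_const_mul, intervalIntegral.integral_const_mul,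
    intervalIntegral.integral_ofReal]
  push_cast
  ring

theorem hasSum_integral_gaussian (β r : ℝ) (hr : 0 < r) (w : ℂ) :
    HasSum (fun c : ℤ ↦ ∫ t in (0 : ℝ)..1, e2 ((t - β : ℝ) * (w + c)) *
        (Real.exp (-Real.pi * Complex.normSq (w + c) / r ^ 2) : ℂ))
      (∫ t in (0 : ℝ)..1, ∑' c : ℤ, e2 ((t - β : ℝ) * (w + c)) *
        (Real.exp (-Real.pi * Complex.normSq (w + c) / r ^ 2) : ℂ)) := by
  have hs := (summable_gaussian r hr w).mul_left (Real.exp (2 * Real.pi * ((1 + |β|) * |w.im|)))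
  have hb : ∀ (c : ℤ) (t : ℝ), t ∈ Set.uIoc (0 : ℝ) 1 → ‖e2 ((t - β : ℝ) * (w + c)) *
      (Real.exp (-Real.pi * Complex.normSq (w + c) / r ^ 2) : ℂ)‖ ≤
      Real.exp (2 * Real.pi * ((1 + |β|) * |w.im|)) *
        Real.exp (-Real.pi * Complex.normSq (w + c) / r ^ 2) := by
    intro c t ht
    rw [Set.uIoc_of_le zero_le_one] at ht
    rw [norm_mul, norm_e2, Complex.norm_real, Real.norm_of_nonneg (Real.exp_pos _).le]
    refine mul_le_mul_of_nonneg_right (Real.exp_le_exp.2 ?_) (Real.exp_pos _).le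
    have him : (((t - β : ℝ) : ℂ) * (w + c)).im = (t - β) * w.im := by
      rw [Complex.im_ofReal_mul]
      simp
    rw [him]
    have h1 : |(t - β) * w.im| ≤ (1 + |β|) * |w.im| := by
      rw [abs_mul]
      refine mul_le_mul_of_nonneg_right ((abs_sub _ _).trans ?_) (abs_nonneg _)
      rw [abs_of_pos ht.1]; linarith [ht.2]
    have h2 := neg_abs_le ((t - β) * w.im)
    nlinarith [Real.pi_pos]
  refine intervalIntegral.hasSum_integral_of_dominated_convergence (fun c _ ↦ _) ?_
    (fun c ↦ Filter.Eventually.of_forall (hb c)) (Filter.Eventually.of_forall fun t _ ↦ hs)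
    intervalIntegrable_const (Filter.Eventually.of_forall fun t ht ↦ ?_)
  · intro c
    refine Continuous.aestronglyMeasurable ?_
    exact (continuous_e2.comp (by fun_prop)).mul continuous_const
  · exact (Summable.of_norm_bounded hs fun c ↦ hb c t ht).hasSum

theorem hasSum_integral_gaussian_dual (β r : ℝ) (hr : 0 < r) (w : ℂ) :
    HasSum (fun k : ℤ ↦ ∫ t in (0 : ℝ)..1, r * (e2 (k * w) *
      (Real.exp (-Real.pi * (((t - β) - k + w.im / r ^ 2) * r) ^ 2) : ℂ)))
      (∫ t in (0 : ℝ)..1, ∑' k : ℤ, r * (e2 (k * w) *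
      (Real.exp (-Real.pi * (((t - β) - k + w.im / r ^ 2) * r) ^ 2) : ℂ))) := by
  set h : ℝ := β - w.im / r ^ 2 with hh
  have hs : Summable fun k : ℤ ↦ r * (Real.exp (-(2 * Real.pi * (k * w.im))) *
      Real.exp (-Real.pi * r ^ 2 * ((k + h) ^ 2 / 2 - 1))) := by
    refine ((summable_exp_quadratic_int (p := Real.pi * r ^ 2 / 2) (by positivity)
      (-(2 * Real.pi * w.im) - Real.pi * r ^ 2 * h)
      (-Real.pi * r ^ 2 * (h ^ 2 / 2 - 1))).mul_left r).congr fun k ↦ ?_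
    rw [← Real.exp_add]
    congr 2
    ring
  have hb : ∀ (k : ℤ) (t : ℝ), t ∈ Set.uIoc (0 : ℝ) 1 → ‖r * (e2 (k * w) *
      (Real.exp (-Real.pi * (((t - β) - k + w.im / r ^ 2) * r) ^ 2) : ℂ))‖ ≤
      r * (Real.exp (-(2 * Real.pi * (k * w.im))) *
      Real.exp (-Real.pi * r ^ 2 * ((k + h) ^ 2 / 2 - 1))) := by
    intro k t ht
    rw [Set.uIoc_of_le zero_le_one] at ht
    rw [norm_mul, norm_mul, norm_e2, Complex.norm_real, Complex.norm_real,
      Real.norm_of_nonneg hr.le, Real.norm_of_nonneg (Real.exp_pos _).le]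
    have him : ((k : ℂ) * w).im = k * w.im := by simp
    rw [him]
    refine mul_le_mul_of_nonneg_left (mul_le_mul_of_nonneg_left (Real.exp_le_exp.2 ?_)
      (Real.exp_pos _).le) hr.le
    have h1 : (t - β) - k + w.im / r ^ 2 = t - (k + h) := by rw [hh]; ring
    rw [h1]
    -- With X = k + h, the difference of the two sides is (2t - X)²/2 + 1 - t², which is nonnegative
    -- on [0,1]. This makes the majorant independent of t.
    have h2 : (k + h) ^ 2 / 2 - 1 ≤ (t - (k + h)) ^ 2 := by
      nlinarith [sq_nonneg (2 * t - (k + h)), ht.1, ht.2]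
    have h3 : 0 ≤ Real.pi * r ^ 2 := by positivity
    nlinarith [mul_le_mul_of_nonneg_left h2 h3]
  refine intervalIntegral.hasSum_integral_of_dominated_convergence (fun c _ ↦ _) ?_
    (fun c ↦ Filter.Eventually.of_forall (hb c)) (Filter.Eventually.of_forall fun t _ ↦ hs)
    intervalIntegrable_const (Filter.Eventually.of_forall fun t ht ↦ ?_)
  · intro c
    refine Continuous.aestronglyMeasurable ?_
    fun_prop
  · exact (Summable.of_norm_bounded hs fun c ↦ hb c t ht).hasSum

theorem tsum_rowTerm_eq_tsum_E_sub_E (β r : ℝ) (hr : 0 < r) {w : ℂ} (hw : e2 w ≠ 1) :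
    -1 / (2 * Real.pi * Complex.I) * ∑' c : ℤ, rowTerm β r w c = 1 / (1 - e2 w) *
      ∑' k : ℤ, e2 (k * w) * ((1 / 2 * (E ((k + (β - w.im / r ^ 2)) * r) -
      E ((k - 1 + (β - w.im / r ^ 2)) * r)) : ℝ) : ℂ) := by
  rw [← tsum_mul_left]
  simp only [rowTerm_eq_integral β r hw]
  rw [tsum_mul_left, (hasSum_integral_gaussian β r hr w).tsum_eq]
  congr 1
  simp only [← integral_gaussian_dual_term]
  rw [(hasSum_integral_gaussian_dual β r hr w).tsum_eq]
  refine intervalIntegral.integral_congr fun t _ ↦ ?_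
  simp only [tsum_gaussian_eq_dual _ r hr w, tsum_mul_left]

theorem summable_intSign_sub_E (r δ : ℝ) (hr : 0 < r) (w : ℂ) :
    Summable fun n : ℤ ↦ e2 (n * w) * ((intSign n - E ((n + δ) * r) : ℝ) : ℂ) := by
  have hs := (summable_exp_quadratic_int (p := Real.pi * r ^ 2) (by positivity)
    (-(2 * Real.pi * w.im) - 2 * Real.pi * r ^ 2 * δ) (-Real.pi * r ^ 2 * δ ^ 2)).mul_left
      (2 * Real.exp (Real.pi * (δ * r) ^ 2))
  refine Summable.of_norm_bounded hs fun n ↦ ?_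
  rw [norm_mul, norm_e2, Complex.norm_real, Real.norm_eq_abs]
  have him : ((n : ℂ) * w).im = n * w.im := by simp
  rw [him]
  refine (mul_le_mul_of_nonneg_left (abs_intSign_sub_E_le r δ hr n)
    (Real.exp_pos _).le).trans_eq ?_
  rw [mul_left_comm, ← Real.exp_add]
  congr 2
  ring

/-- Summation by parts. Shifting n by one multiplies the exponential by e2(w), so (1 - e2 w) times
the series in sgn - E has differences of sgn - E as coefficients. The sign jumps only at n = 0, by
2, which produces the isolated term 1/(1 - e2 w). -/
theorem tsum_E_sub_E (r δ : ℝ) (hr : 0 < r) {w : ℂ} (hw : e2 w ≠ 1) :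
    1 / (1 - e2 w) * ∑' n : ℤ, e2 (n * w) *
      ((1 / 2 * (E ((n + δ) * r) - E ((n - 1 + δ) * r)) : ℝ) : ℂ) =
    1 / (1 - e2 w) -
      1 / 2 * ∑' n : ℤ, e2 (n * w) * ((intSign n - E ((n + δ) * r) : ℝ) : ℂ) := by
  have h1 : (1 - e2 w) ≠ 0 := sub_ne_zero.2 (Ne.symm hw)
  have hG := (summable_intSign_sub_E r δ hr w).hasSum
  set G := ∑' n : ℤ, e2 (n * w) * ((intSign n - E ((n + δ) * r) : ℝ) : ℂ)
  have hG' := ((Equiv.subRight (1 : ℤ)).hasSum_iff.2 hG).mul_left (e2 w)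
  have h0 : HasSum (fun n : ℤ ↦ if n = 0 then (2 : ℂ) else 0) 2 := hasSum_ite_eq 0 2
  have key := (((h0.sub hG).add hG').mul_left (1 / 2)).tsum_eq
  have hterm : ∀ n : ℤ, e2 (n * w) *
      ((1 / 2 * (E ((n + δ) * r) - E ((n - 1 + δ) * r)) : ℝ) : ℂ) =
      1 / 2 * ((if n = 0 then 2 else 0) - e2 (n * w) * ((intSign n - E ((n + δ) * r) : ℝ) : ℂ) +
      e2 w * ((fun n : ℤ ↦ e2 (n * w) * ((intSign n - E ((n + δ) * r) : ℝ) : ℂ)) ∘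
        (Equiv.subRight (1 : ℤ))) n) := by
    intro n
    have h2 : e2 w * e2 (((n - 1 : ℤ) : ℂ) * w) = e2 (n * w) := by
      rw [← e2_add]; congr 1; push_cast; ring
    simp only [Function.comp, Equiv.subRight_apply]
    rw [← mul_assoc (e2 w), h2]
    have h3 : (if n = 0 then (2 : ℂ) else 0) =
        e2 (n * w) * ((intSign n - intSign (n - 1) : ℝ) : ℂ) := by
      rcases lt_trichotomy n 0 with h | h | h
      · simp [intSign, h.ne, not_le.2 h, not_le.2 (show n < 1 by omega)]
      · subst h; norm_num [intSign, e2_zero]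
      · simp [intSign, h.ne', h.le, show 1 ≤ n by omega]
    rw [h3]
    push_cast
    ring
  rw [tsum_congr hterm, key]
  field_simp
  ring

/-- The free shift N serves to make the offset δ the same in every row: for row a it is taken to be
ma, cancelling the contribution of aτ to Im w. -/
theorem tsum_rowTerm (β r : ℝ) (hr : 0 < r) {w : ℂ} (hw : e2 w ≠ 1) (N : ℤ) (δ : ℝ)
    (hδ : δ = β - w.im / r ^ 2 + N) :
    -1 / (2 * Real.pi * Complex.I) * ∑' c : ℤ, rowTerm β r w c = e2 (N * w) *
      (1 / (1 - e2 w) -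
        1 / 2 * ∑' n : ℤ, e2 (n * w) * ((intSign n - E ((n + δ) * r) : ℝ) : ℂ)) := by
  rw [tsum_rowTerm_eq_tsum_E_sub_E β r hr hw, ← tsum_E_sub_E r δ hr hw,
    ← (Equiv.addRight N).tsum_eq (fun k : ℤ ↦ e2 (k * w) *
      ((1 / 2 * (E ((k + (β - w.im / r ^ 2)) * r) -
        E ((k - 1 + (β - w.im / r ^ 2)) * r)) : ℝ) : ℂ)), mul_left_comm,
    ← tsum_mul_left (a := e2 (N * w))]
  congr 1
  refine tsum_congr fun n ↦ ?_
  rw [Equiv.coe_addRight, ← mul_assoc, ← e2_add]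
  congr 2
  · push_cast; ring
  · rw [hδ]
    push_cast
    congr 4 <;> ring

/-! ### The completed Appell function as an absolutely convergent lattice sum -/

/-- The summand of the lattice sum of index `μ` attached to the lattice point `aτ + c`. -/
noncomputable def latticeTerm (μ : ℝ) (τ z₁ z₂ : ℂ) (a c : ℤ) : ℂ :=
  e2 (μ * (a * z₂ - (z₂.im / τ.im : ℝ) * (z₁ + a * τ + c))) *
    Real.exp (-Real.pi * μ / τ.im * Complex.normSq (z₁ + a * τ + c)) / (z₁ + a * τ + c)

/-- The modular completion of `Φ₁^{[m;0]}`, written as a sum over the lattice `ℤτ + ℤ`. -/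
noncomputable def appellCompletion (m : ℕ) (τ z₁ z₂ : ℂ) : ℂ :=
  -1 / (2 * Real.pi * Complex.I) * ∑' x : ℤ × ℤ, latticeTerm m τ z₁ z₂ x.1 x.2

theorem summable_exp_normSq_lattice {A : ℝ} (hA : 0 < A) {τ : ℂ} (hτ : 0 < τ.im) (z : ℂ) :
    Summable fun x : ℤ × ℤ ↦ Real.exp (-A * Complex.normSq (z + x.1 * τ + x.2)) := by
  refine (summable_exp_quadratic_int_sq (p := A * (τ.re ^ 2 + τ.im ^ 2)) (q := A * τ.re) (r := A)
    (by positivity) ?_ (-2 * A * (z.re * τ.re + z.im * τ.im)) (-2 * A * z.re)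
    (-A * (z.re ^ 2 + z.im ^ 2))).congr fun x ↦ ?_
  · have : 0 < A ^ 2 * τ.im ^ 2 := by positivity
    nlinarith
  · congr 1
    simp only [Complex.normSq_apply, Complex.add_re, Complex.add_im, Complex.mul_re,
      Complex.mul_im, Complex.intCast_re, Complex.intCast_im]
    ring

/-- The exponent is built so that its imaginary part does not depend on a and c, which leaves a pure
Gaussian over |w|. -/
theorem norm_latticeTerm {μ : ℝ} {τ : ℂ} (hτ : 0 < τ.im) (z₁ z₂ : ℂ) (a c : ℤ) :
    ‖latticeTerm μ τ z₁ z₂ a c‖ = Real.exp (2 * Real.pi * μ * (z₂.im / τ.im) * z₁.im) *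
      Real.exp (-(Real.pi * μ / τ.im) * Complex.normSq (z₁ + a * τ + c)) /
        ‖z₁ + a * τ + c‖ := by
  rw [latticeTerm, norm_div, norm_mul, norm_e2, Complex.norm_real,
    Real.norm_of_nonneg (Real.exp_pos _).le]
  congr 3
  · have : (μ * (a * z₂ - (z₂.im / τ.im : ℝ) * (z₁ + a * τ + c)) : ℂ).im =
        μ * (a * z₂.im - (z₂.im / τ.im) * (z₁.im + a * τ.im)) := by
      rw [Complex.im_ofReal_mul, Complex.sub_im, Complex.im_ofReal_mul]
      simp
    rw [this]
    field_simp
    ring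
  · ring

theorem summable_latticeTerm {μ : ℝ} (hμ : 0 < μ) {τ : ℂ} (hτ : 0 < τ.im) (z₁ z₂ : ℂ) :
    Summable fun x : ℤ × ℤ ↦ latticeTerm μ τ z₁ z₂ x.1 x.2 := by
  have hA : 0 < Real.pi * μ / τ.im := by positivity
  have hs := summable_exp_normSq_lattice hA hτ z₁
  refine Summable.of_norm_bounded_eventually
    (hs.mul_left (Real.exp (2 * Real.pi * μ * (z₂.im / τ.im) * z₁.im))) ?_
  -- Away from finitely many lattice points the Gaussian is below its value at |w| = 1, so |w| > 1
  -- and the denominator only helps.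
  have hev := hs.tendsto_cofinite_zero.eventually_lt_const
    (Real.exp_pos (-(Real.pi * μ / τ.im) * 1))
  filter_upwards [hev] with x hx
  rw [norm_latticeTerm hτ]
  refine div_le_self (by positivity) ?_
  have h1 := Real.exp_lt_exp.1 hx
  have h2 : 1 < Complex.normSq (z₁ + x.1 * τ + x.2) := by nlinarith
  rw [Complex.normSq_eq_norm_sq] at h2
  nlinarith [norm_nonneg (z₁ + x.1 * τ + x.2)]

theorem latticeTerm_eq_rowTerm {m : ℕ} (hm : 0 < m) {τ : ℂ} (hτ : 0 < τ.im) (z₁ z₂ : ℂ)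
    (a c : ℤ) : latticeTerm m τ z₁ z₂ a c = e2 (m * a * z₂) *
      rowTerm (m * (z₂.im / τ.im)) (Real.sqrt (τ.im / m)) (z₁ + a * τ) c := by
  have hm' : (0 : ℝ) < m := by exact_mod_cast hm
  rw [latticeTerm, rowTerm, ← mul_div_assoc, ← mul_assoc, ← e2_add,
    Real.sq_sqrt (by positivity)]
  have h : -Real.pi * m / τ.im * Complex.normSq (z₁ + a * τ + c) =
      -Real.pi * Complex.normSq (z₁ + a * τ + c) / (τ.im / m) := by field_simp
  rw [h]
  congr 3
  push_cast; ring

/-- The general term of the double series of the nonholomorphic part. -/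
noncomputable def correctionTerm (m : ℕ) (τ z₁ z₂ : ℂ) (a n : ℤ) : ℂ :=
  e2 (m * a * (z₁ + z₂) + a ^ 2 * m * τ + n * (z₁ + a * τ)) *
    ((intSign n - E ((n + m * ((z₂.im - z₁.im) / τ.im)) * Real.sqrt (τ.im / m)) : ℝ) : ℂ)

/-- The form ma² + an in the exponential is indefinite. The Gaussian decay of sgn - E in n
contributes n²/(2m) on the same scale and makes the total positive definite. -/
theorem summable_correctionTerm {m : ℕ} (hm : 0 < m) {τ : ℂ} (hτ : 0 < τ.im) (z₁ z₂ : ℂ) :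
    Summable fun x : ℤ × ℤ ↦ correctionTerm m τ z₁ z₂ x.1 x.2 := by
  have hm' : (0 : ℝ) < m := by exact_mod_cast hm
  have hr : 0 < Real.sqrt (τ.im / m) := by positivity
  set δ := m * ((z₂.im - z₁.im) / τ.im) with hδ
  have hs := (summable_exp_quadratic_int_sq (p := 2 * Real.pi * m * τ.im) (q := Real.pi * τ.im)
    (r := Real.pi * (τ.im / m)) (by positivity) (by
      have : 2 * Real.pi * m * τ.im * (Real.pi * (τ.im / m)) = 2 * (Real.pi * τ.im) ^ 2 := by
        field_simp
      rw [this]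
      have : 0 < (Real.pi * τ.im) ^ 2 := by positivity
      linarith) (-(2 * Real.pi * (m * (z₁.im + z₂.im))))
    (-(2 * Real.pi * z₁.im) - 2 * Real.pi * (τ.im / m) * δ)
    (-Real.pi * (τ.im / m) * δ ^ 2)).mul_left
      (2 * Real.exp (Real.pi * (δ * Real.sqrt (τ.im / m)) ^ 2))
  refine Summable.of_norm_bounded hs fun x ↦ ?_
  rw [correctionTerm, norm_mul, norm_e2, Complex.norm_real, Real.norm_eq_abs]
  refine (mul_le_mul_of_nonneg_left (abs_intSign_sub_E_le _ δ hr x.2)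
    (Real.exp_pos _).le).trans_eq ?_
  rw [mul_left_comm, ← Real.exp_add]
  congr 2
  have him : (m * x.1 * (z₁ + z₂) + x.1 ^ 2 * m * τ + x.2 * (z₁ + x.1 * τ) : ℂ).im =
      m * x.1 * (z₁.im + z₂.im) + x.1 ^ 2 * m * τ.im + x.2 * (z₁.im + x.1 * τ.im) := by
    have h1 : (m * x.1 : ℂ) = ((m * x.1 : ℝ) : ℂ) := by push_cast; rfl
    have h2 : (x.1 ^ 2 * m : ℂ) = ((x.1 ^ 2 * m : ℝ) : ℂ) := by push_cast; rfl
    rw [h1, h2, Complex.add_im, Complex.add_im, Complex.im_ofReal_mul, Complex.im_ofReal_mul]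
    simp
  rw [him, mul_pow, Real.sq_sqrt (by positivity)]
  ring

/-! ### Identification of the lattice sum with Φ₁ and its correction -/

theorem e2_ne_one_of_notMem_lattice {τ z : ℂ} (hz : ∀ p l : ℤ, z ≠ p + l * τ) (a : ℤ) :
    e2 (z + a * τ) ≠ 1 := by
  intro h
  obtain ⟨p, hp⟩ := (e2_eq_one_iff _).1 h
  refine hz p (-a) ?_
  rw [← hp]; push_cast; ring

theorem tsum_row_latticeTerm {m : ℕ} (hm : 0 < m) {τ : ℂ} (hτ : 0 < τ.im) {z₁ : ℂ} (z₂ : ℂ)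
    (hz : ∀ p l : ℤ, z₁ ≠ p + l * τ) (a : ℤ) :
    -1 / (2 * Real.pi * Complex.I) * ∑' c : ℤ, latticeTerm m τ z₁ z₂ a c =
      e2 (m * a * (z₁ + z₂)) * e2 (a ^ 2 * m * τ) / (1 - e2 z₁ * e2 (a * τ)) -
      1 / 2 * ∑' n : ℤ, correctionTerm m τ z₁ z₂ a n := by
  have hm' : (0 : ℝ) < m := by exact_mod_cast hm
  have hr : 0 < Real.sqrt (τ.im / m) := by positivity
  simp only [latticeTerm_eq_rowTerm hm hτ, tsum_mul_left]
  rw [mul_left_comm, tsum_rowTerm _ _ hr (e2_ne_one_of_notMem_lattice hz a) (m * a)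
    (m * ((z₂.im - z₁.im) / τ.im)) ?_, mul_sub, mul_sub, ← mul_assoc, ← e2_add, ← e2_add]
  · congr 1
    · rw [mul_one_div, ← e2_add]
      congr 2
      push_cast; ring
    · rw [← mul_assoc, ← e2_add, mul_left_comm, ← tsum_mul_left]
      congr 1
      refine tsum_congr fun n ↦ ?_
      rw [correctionTerm, ← mul_assoc, ← e2_add]
      congr 2
      push_cast; ring
  · have : (z₁ + a * τ).im = z₁.im + a * τ.im := by simp
    rw [this, Real.sq_sqrt (by positivity)]
    push_cast
    field_simp
    ring

theorem appellCompletion_eq_sub_tsum {m : ℕ} (hm : 0 < m) {τ : ℂ} (hτ : 0 < τ.im) {z₁ : ℂ}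
    (z₂ : ℂ) (hz : ∀ p l : ℤ, z₁ ≠ p + l * τ) :
    appellCompletion m τ z₁ z₂ = Phi₁ m 0 τ z₁ z₂ -
      1 / 2 * ∑' n : ℤ, ∑' a : ℤ, correctionTerm m τ z₁ z₂ a n := by
  have hm' : (0 : ℝ) < m := by exact_mod_cast hm
  have hs := summable_latticeTerm hm' hτ z₁ z₂
  have hc := summable_correctionTerm hm hτ z₁ z₂
  have hY : Summable fun a : ℤ ↦ (1 / 2 : ℂ) * ∑' n : ℤ, correctionTerm m τ z₁ z₂ a n :=
    hc.prod.mul_left _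
  have hrow : Summable fun a : ℤ ↦
      -1 / (2 * Real.pi * Complex.I) * ∑' c : ℤ, latticeTerm m τ z₁ z₂ a c :=
    hs.prod.mul_left _
  -- Each term of Φ₁ is a row of the lattice sum plus a row of the correction, so convergence is
  -- inherited from those two.
  have hX : Summable fun a : ℤ ↦
      e2 (m * a * (z₁ + z₂)) * e2 (a ^ 2 * m * τ) / (1 - e2 z₁ * e2 (a * τ)) := by
    refine (hrow.add hY).congr fun a ↦ ?_
    rw [tsum_row_latticeTerm hm hτ z₂ hz a, sub_add_cancel]
  have hcomm : ∑' n : ℤ, ∑' a : ℤ, correctionTerm m τ z₁ z₂ a n =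
      ∑' a : ℤ, ∑' n : ℤ, correctionTerm m τ z₁ z₂ a n := Summable.tsum_comm hc
  have hΦ : Phi₁ m 0 τ z₁ z₂ = ∑' a : ℤ,
      e2 (m * a * (z₁ + z₂)) * e2 (a ^ 2 * m * τ) / (1 - e2 z₁ * e2 (a * τ)) := by
    refine tsum_congr fun a ↦ ?_
    simp only [Complex.ofReal_zero, zero_mul, mul_zero, add_zero]
  rw [hcomm, hΦ, ← tsum_mul_left, ← hX.tsum_sub hY, appellCompletion, hs.tsum_prod,
    ← tsum_mul_left]
  exact tsum_congr fun a ↦ tsum_row_latticeTerm hm hτ z₂ hz a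

/-! ### Regrouping by residues modulo 2m: the functions R and Θ -/

theorem tsum_int_eq_sum_range_tsum {N : ℕ} (hN : 0 < N) {g : ℤ → ℂ} (hg : Summable g) :
    ∑' n : ℤ, g n = ∑ i ∈ Finset.range N, ∑' k : ℤ, g (i + N * k) := by
  have : NeZero N := ⟨hN.ne'⟩
  let e : Fin N × ℤ ≃ ℤ := (Equiv.prodComm _ _).trans (Int.divModEquiv N).symm
  have he : ∀ x, e x = x.1 + N * x.2 := by
    intro x
    simp [e, Int.divModEquiv]
    ring
  have hprod : ∑' x, g (e x) = ∑' i : Fin N, ∑' k : ℤ, g (e (i, k)) :=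
    (e.summable_iff.2 hg).tsum_prod
  rw [← e.tsum_eq, hprod, tsum_fintype,
    ← Fin.sum_univ_eq_sum_range (fun i ↦ ∑' k : ℤ, g (i + N * k))]
  simp only [he]

theorem Theta_add_period {m : ℕ} (hm : 0 < m) (j : ℝ) (k : ℤ) (τ z t : ℂ) :
    Theta (j + 2 * m * k) m τ z t = Theta j m τ z t := by
  have hm' : (m : ℂ) ≠ 0 := by exact_mod_cast hm.ne'
  rw [Theta, Theta]
  congr 1
  rw [← (Equiv.addRight k).tsum_eq (fun a : ℤ ↦ e2 (m * ((a : ℂ) + j / (2 * m)) ^ 2 * τ) *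
    e2 (m * ((a : ℂ) + j / (2 * m)) * z))]
  refine tsum_congr fun a ↦ ?_
  have : (a : ℂ) + ((j + 2 * m * k : ℝ) : ℂ) / (2 * m) =
      ((Equiv.addRight k a : ℤ) : ℂ) + j / (2 * m) := by
    simp only [Equiv.coe_addRight]
    push_cast
    field_simp
    ring
  rw [this]

theorem Theta_neg (j : ℝ) (m : ℕ) (τ z t : ℂ) : Theta (-j) m τ z t = Theta j m τ (-z) t := by
  rw [Theta, Theta]
  congr 1
  rw [← (Equiv.neg ℤ).tsum_eq]
  refine tsum_congr fun a ↦ ?_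
  simp only [Equiv.neg_apply]
  congr 2 <;> push_cast <;> ring

/-- Put ν = i + 2mk. Expanding m(a + ν/2m)² = ma² + aν + ν²/4m, the last term cancels the Gaussian
factor of `RTerm`. -/
theorem RTerm_mul_Theta {m : ℕ} (hm : 0 < m) {τ : ℂ} (z₁ z₂ : ℂ) {i : ℕ}
    (hi : i < 2 * m) (k : ℤ) :
    RTerm i m τ ((z₁ - z₂) / 2) (i + 2 * m * k) * Theta i m τ (z₁ + z₂) 0 =
      ∑' a : ℤ, correctionTerm m τ z₁ z₂ a (i + (2 * m : ℕ) * k) := by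
  have hm' : (m : ℂ) ≠ 0 := by exact_mod_cast hm.ne'
  -- The argument of the sign is 2m(k + 1) - 1/2, positive exactly for k ≥ 0. Because 0 ≤ i < 2m,
  -- this is also when i + 2mk ≥ 0.
  have hsign : Real.sign ((i + 2 * m * k : ℝ) - 1 / 2 - i + 2 * m) =
      intSign (i + (2 * m : ℕ) * k) := by
    have hm1 : (1 : ℝ) ≤ m := by exact_mod_cast hm
    unfold intSign
    split_ifs with h
    · have hk : 0 ≤ k := by
        by_contra! hk
        push_cast at h
        nlinarith
      have hk' : (0 : ℝ) ≤ k := by exact_mod_cast hk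
      apply Real.sign_of_pos
      nlinarith
    · have hk : k ≤ -1 := by
        by_contra! hk
        have : 0 ≤ k := by omega
        exact h (by positivity)
      have hk' : (k : ℝ) ≤ -1 := by exact_mod_cast hk
      apply Real.sign_of_neg
      nlinarith
  have him : ((z₁ - z₂) / 2).im = (z₁.im - z₂.im) / 2 := by
    rw [Complex.div_ofNat_im, Complex.sub_im]
  rw [← Theta_add_period hm (i : ℝ) k, Theta, ← mul_assoc, ← tsum_mul_left]
  refine tsum_congr fun a ↦ ?_
  rw [RTerm, correctionTerm, hsign, him, mul_zero, e2_zero, mul_one, mul_assoc, mul_comm]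
  congr 1
  · simp only [e2, ← Complex.exp_add]
    congr 1
    push_cast
    field_simp
    ring
  · congr 4
    push_cast
    ring

theorem appellCompletion_eq {m : ℕ} (hm : 0 < m) {τ : ℂ} (hτ : 0 < τ.im) {z₁ : ℂ}
    (z₂ : ℂ) (hz : ∀ p l : ℤ, z₁ ≠ p + l * τ) :
    appellCompletion m τ z₁ z₂ = Phi₁ m 0 τ z₁ z₂ - 1 / 2 * ∑ i ∈ Finset.range (2 * m),
      R (0 + i) m τ ((z₁ - z₂) / 2) * Theta (0 + i) m τ (z₁ + z₂) 0 := by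
  have hc := summable_correctionTerm hm hτ z₁ z₂
  have hc' : Summable fun n : ℤ ↦ ∑' a : ℤ, correctionTerm m τ z₁ z₂ a n := hc.prod_symm.prod
  rw [appellCompletion_eq_sub_tsum hm hτ z₂ hz,
    tsum_int_eq_sum_range_tsum (N := 2 * m) (by omega) hc']
  congr 2
  refine Finset.sum_congr rfl fun i hi ↦ ?_
  rw [zero_add, R, ← tsum_mul_right]
  refine tsum_congr fun k ↦ ?_
  rw [RTerm_mul_Theta hm z₁ z₂ (Finset.mem_range.1 hi)]

/-- The swap (z₁, z₂) ↦ (-z₂, -z₁) preserves z₁ - z₂ and negates z₁ + z₂. So it fixes the `R`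
factors and turns Θ_i into Θ_{-i}, as in `PhiAdd`. -/
theorem PhiTilde_eq {m : ℕ} (hm : 0 < m) {τ : ℂ} (hτ : 0 < τ.im) {z₁ z₂ : ℂ}
    (hz : PhiRegular τ z₁ z₂) :
    PhiTilde m 0 τ z₁ z₂ 0 = appellCompletion m τ z₁ z₂ - appellCompletion m τ (-z₂) (-z₁) := by
  have h2 : ∀ p l : ℤ, -z₂ ≠ p + l * τ := by
    intro p l h
    refine (hz (-p) (-l)).2 ?_
    rw [← neg_neg z₂, h]; push_cast; ring
  rw [appellCompletion_eq hm hτ z₂ fun p l ↦ (hz p l).1, appellCompletion_eq hm hτ (-z₁) h2,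
    PhiTilde, Phi, PhiAdd, mul_zero, e2_zero, neg_sub_neg, one_mul, mul_one]
  have h3 : -z₂ + -z₁ = -(z₁ + z₂) := by ring
  simp only [mul_sub, Finset.sum_sub_distrib, Theta_neg, h3]
  ring

/-! ### Transformation laws of the lattice sum -/

/-- Dividing by τ sends z₁ + cτ - a to the point of index (a, c) for -1/τ. The Gaussian is unchanged
because |w|²/Im τ is invariant. -/
theorem latticeTerm_neg_one_div (μ : ℝ) {τ : ℂ} (hτ : 0 < τ.im) (z₁ z₂ : ℂ) (a c : ℤ) :
    latticeTerm μ (-1 / τ) (z₁ / τ) (z₂ / τ) a c =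
      τ * e2 (μ * (z₁ * z₂ / τ)) * latticeTerm μ τ z₁ z₂ c (-a) := by
  have hτ0 : τ ≠ 0 := by rintro rfl; simp at hτ
  have hN : Complex.normSq τ ≠ 0 := by simpa using hτ0
  have hw : z₁ / τ + a * (-1 / τ) + c = (z₁ + c * τ + (-a : ℤ)) / τ := by
    push_cast; field_simp; ring
  have him : (-1 / τ).im = τ.im / Complex.normSq τ := by
    rw [neg_div, one_div, Complex.neg_im, Complex.inv_im]; ring
  have hz : (z₂ / τ).im = (z₂.im * τ.re - z₂.re * τ.im) / Complex.normSq τ := by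
    rw [Complex.div_im]; ring
  rw [latticeTerm, latticeTerm, hw, him, hz, Complex.normSq_div]
  have hy : (τ.im : ℂ) ≠ 0 := by exact_mod_cast hτ.ne'
  have hy' := hτ.ne'
  have h1 : -Real.pi * μ / (τ.im / Complex.normSq τ) *
      (Complex.normSq (z₁ + c * τ + (-a : ℤ)) / Complex.normSq τ) =
      -Real.pi * μ / τ.im * Complex.normSq (z₁ + c * τ + (-a : ℤ)) := by field_simp
  have h2 : (z₂.im * τ.re - z₂.re * τ.im) / Complex.normSq τ / (τ.im / Complex.normSq τ) =
      (z₂.im * τ.re - z₂.re * τ.im) / τ.im := by field_simp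
  rw [h1, h2, div_div_eq_mul_div]
  have h3 : e2 (μ * (a * (z₂ / τ) - (((z₂.im * τ.re - z₂.re * τ.im) / τ.im : ℝ) : ℂ) *
      ((z₁ + c * τ + (-a : ℤ)) / τ))) = e2 (μ * (z₁ * z₂ / τ)) *
      e2 (μ * (c * z₂ - (z₂.im / τ.im : ℝ) * (z₁ + c * τ + (-a : ℤ)))) := by
    rw [← e2_add]
    congr 1
    have e1 := Complex.re_add_im z₂
    have e2 := Complex.re_add_im τ
    push_cast
    field_simp
    have e3 : (z₂.im * τ.re - z₂.re * τ.im : ℂ) = z₂.im * τ - z₂ * τ.im := by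
      linear_combination (-(z₂.im : ℂ)) * e2.symm + (τ.im : ℂ) * e1.symm
    rw [e3]
    ring
  rw [h3]
  ring

theorem appellCompletion_neg_one_div (m : ℕ) {τ : ℂ} (hτ : 0 < τ.im) (z₁ z₂ : ℂ) :
    appellCompletion m (-1 / τ) (z₁ / τ) (z₂ / τ) =
      τ * e2 (m * (z₁ * z₂ / τ)) * appellCompletion m τ z₁ z₂ := by
  let e : ℤ × ℤ ≃ ℤ × ℤ := (Equiv.prodComm ℤ ℤ).trans ((Equiv.refl ℤ).prodCongr (Equiv.neg ℤ))
  rw [appellCompletion, appellCompletion, mul_left_comm,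
    ← tsum_mul_left (a := τ * e2 (m * (z₁ * z₂ / τ))),
    ← e.tsum_eq (fun x : ℤ × ℤ ↦ τ * e2 (m * (z₁ * z₂ / τ)) * latticeTerm m τ z₁ z₂ x.1 x.2)]
  congr 1
  refine tsum_congr fun x ↦ ?_
  rw [latticeTerm_neg_one_div m hτ]
  simp only [e, Equiv.trans_apply, Equiv.prodComm_apply, Equiv.prodCongr_apply, Prod.map,
    Equiv.refl_apply, Equiv.neg_apply, Prod.fst_swap, Prod.snd_swap, Complex.ofReal_natCast]

theorem appellCompletion_add_int (m : ℕ) {τ : ℂ} (N d₁ d₂ : ℤ) (z₁ z₂ : ℂ) :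
    appellCompletion m (τ + N) (z₁ + d₁) (z₂ + d₂) = appellCompletion m τ z₁ z₂ := by
  let e : ℤ × ℤ ≃ ℤ × ℤ := Equiv.prodShear (Equiv.refl ℤ) fun a ↦ Equiv.addRight (d₁ + a * N)
  rw [appellCompletion, appellCompletion,
    ← e.tsum_eq (fun x : ℤ × ℤ ↦ latticeTerm m τ z₁ z₂ x.1 x.2)]
  congr 1
  refine tsum_congr fun x ↦ ?_
  have hw : z₁ + d₁ + x.1 * (τ + N) + x.2 = z₁ + x.1 * τ + ((x.2 + (d₁ + x.1 * N) : ℤ) : ℂ) := by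
    push_cast; ring
  have h1 : (z₂ + d₂).im = z₂.im := by simp
  have h2 : (τ + N).im = τ.im := by simp
  simp only [latticeTerm, hw, h1, h2, e, Equiv.prodShear_apply, Equiv.refl_apply,
    Equiv.coe_addRight]
  congr 2
  -- The only leftover factor is e2(m·a·d₂), which is trivial because m is an integer.
  refine e2_eq_e2_of_sub_int (m * x.1 * d₂) ?_
  push_cast
  ring

/-! ### The distribution relation -/

/-- The part of the lattice sum over `a + Mℤ`, twisted by the character attached to `b`. -/
noncomputable def latticeSumMod (M m : ℕ) (τ z₁ z₂ : ℂ) (a b : ℤ) : ℂ :=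
  -1 / (2 * Real.pi * Complex.I) * ∑' x : ℤ × ℤ,
    e2 (-(m / M * b * x.2)) * latticeTerm (m / M) τ z₁ z₂ (a + M * x.1) x.2

/-- The points with first coordinate in a + Mℤ form a translate by aτ of the lattice ℤMτ + ℤ. Index
m/M for τ becomes index m for Mτ, and the character is absorbed by shifting z₂ by bτ. -/
theorem latticeSumMod_eq {M : ℕ} (hM : M ≠ 0) (m : ℕ) {τ : ℂ} (hτ : 0 < τ.im) (z₁ z₂ : ℂ)
    (a b : ℤ) : latticeSumMod M m τ z₁ z₂ a b =
      e2 (m * a * b / M * τ + m / M * (b * z₁ + a * z₂)) *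
        appellCompletion m (M * τ) (z₁ + a * τ) (z₂ + b * τ) := by
  have hM' : (M : ℝ) ≠ 0 := by exact_mod_cast hM
  have hMc : (M : ℂ) ≠ 0 := by exact_mod_cast hM
  have hy : (τ.im : ℂ) ≠ 0 := by exact_mod_cast hτ.ne'
  rw [latticeSumMod, appellCompletion, mul_left_comm,
    ← tsum_mul_left (a := e2 (m * a * b / M * τ + m / M * (b * z₁ + a * z₂)))]
  congr 1
  refine tsum_congr fun x ↦ ?_
  have hw : z₁ + a * τ + x.1 * (M * τ) + x.2 = z₁ + ((a + M * x.1 : ℤ) : ℂ) * τ + x.2 := by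
    push_cast; ring
  have h1 : (M * τ).im = M * τ.im := by simp
  have h2 : (z₂ + b * τ).im = z₂.im + b * τ.im := by simp
  have h3 : ∀ x y u v : ℂ, x * (y * u / v) = x * y * u / v := by intros; ring
  rw [latticeTerm, latticeTerm, hw, h1, h2, h3, h3, ← e2_add, ← e2_add]
  congr 3
  · push_cast
    field_simp
    ring
  · congr 1
    field_simp

theorem latticeSumMod_congr {M : ℕ} (hM : M ≠ 0) (m : ℕ) (τ z₁ z₂ : ℂ) {a a' b b' : ℤ}
    (ha : (M : ℤ) ∣ a' - a) (hb : (M : ℤ) ∣ b' - b) :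
    latticeSumMod M m τ z₁ z₂ a b = latticeSumMod M m τ z₁ z₂ a' b' := by
  have hMc : (M : ℂ) ≠ 0 := by exact_mod_cast hM
  obtain ⟨s, hs⟩ := ha
  obtain ⟨t, ht⟩ := hb
  let e : ℤ × ℤ ≃ ℤ × ℤ := (Equiv.addRight s).prodCongr (Equiv.refl ℤ)
  rw [latticeSumMod, latticeSumMod, ← e.tsum_eq (fun x : ℤ × ℤ ↦
    e2 (-(m / M * b * x.2)) * latticeTerm (m / M) τ z₁ z₂ (a + M * x.1) x.2)]
  congr 1
  refine tsum_congr fun x ↦ ?_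
  have h1 : a + M * (e x).1 = a' + M * x.1 := by
    simp only [e, Equiv.prodCongr_apply, Prod.map, Equiv.coe_addRight]
    linear_combination -hs
  rw [h1]
  congr 1
  refine e2_eq_e2_of_sub_int (m * t * x.2) ?_
  have hb' : (b' : ℂ) = b + M * t := by
    rw [← Int.cast_natCast M, ← Int.cast_mul, ← ht]; push_cast; ring
  simp only [e, Equiv.prodCongr_apply, Prod.map, Equiv.refl_apply]
  rw [hb']
  push_cast
  field_simp
  ring

theorem sum_range_e2 {M m : ℕ} (hM : M ≠ 0) (hMm : Nat.Coprime m M) (c : ℤ) :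
    ∑ b ∈ Finset.range M, e2 (-(m / M * (b : ℤ) * c)) = if (M : ℤ) ∣ c then (M : ℂ) else 0 := by
  have hMc : (M : ℂ) ≠ 0 := by exact_mod_cast hM
  have hpow : ∀ b : ℕ, e2 (-(m / M * (b : ℤ) * c)) = e2 (-(m / M * c)) ^ b := by
    intro b
    rw [e2, e2, ← Complex.exp_nat_mul]
    congr 1; push_cast; ring
  simp only [hpow]
  split_ifs with h
  · obtain ⟨d, rfl⟩ := h
    have : e2 (-(m / M * ((M * d : ℤ) : ℂ))) = 1 := by
      rw [e2_eq_one_iff]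
      refine ⟨-(m * d), ?_⟩
      push_cast; field_simp
    simp only [this, one_pow, Finset.sum_const, Finset.card_range, nsmul_eq_mul, mul_one]
  · have hne : e2 (-(m / M * c)) ≠ 1 := by
      rw [Ne, e2_eq_one_iff]
      rintro ⟨d, hd⟩
      apply h
      have h1 : (m : ℂ) * c = M * (-d) := by
        rw [← hd]; field_simp
      have h2 : (m : ℤ) * c = M * (-d) := by exact_mod_cast h1
      have h3 : IsCoprime (M : ℤ) m := Nat.isCoprime_iff_coprime.2 hMm.symm
      exact h3.dvd_of_dvd_mul_left ⟨-d, h2⟩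
    rw [geom_sum_eq hne, ← hpow]
    have : e2 (-(m / M * ((M : ℤ) : ℂ) * c)) = 1 := by
      rw [e2_eq_one_iff]
      refine ⟨-(m * c), ?_⟩
      push_cast; field_simp
    rw [this]
    simp

theorem tsum_ite_dvd {M : ℕ} (hM : M ≠ 0) (g : ℤ → ℂ) :
    ∑' c : ℤ, (if (M : ℤ) ∣ c then g c else 0) = ∑' c : ℤ, g (M * c) := by
  have hM' : (M : ℤ) ≠ 0 := by exact_mod_cast hM
  have hinj : Function.Injective fun c : ℤ ↦ (M : ℤ) * c := mul_right_injective₀ hM'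
  rw [← hinj.tsum_eq]
  · simp
  · intro c hc
    by_contra h
    refine hc (if_neg ?_)
    rintro ⟨d, rfl⟩
    exact h ⟨d, rfl⟩

theorem latticeTerm_div_nat {M : ℕ} (hM : M ≠ 0) (m : ℕ) {τ : ℂ} (hτ : 0 < τ.im) (z₁ z₂ : ℂ)
    (a c : ℤ) : latticeTerm m (τ / M) (z₁ / M) (z₂ / M) a c =
      M * latticeTerm (m / M) τ z₁ z₂ a (M * c) := by
  have hM' : (M : ℝ) ≠ 0 := by exact_mod_cast hM
  have hMc : (M : ℂ) ≠ 0 := by exact_mod_cast hM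
  have hy : (τ.im : ℂ) ≠ 0 := by exact_mod_cast hτ.ne'
  have hw : z₁ / M + a * (τ / M) + c = (z₁ + a * τ + ((M * c : ℤ) : ℂ)) / M := by
    push_cast; field_simp
  have h1 : (τ / M).im = τ.im / M := Complex.div_natCast_im _ _
  have h2 : (z₂ / M).im = z₂.im / M := Complex.div_natCast_im _ _
  rw [latticeTerm, latticeTerm, hw, h1, h2, Complex.normSq_div, Complex.normSq_natCast,
    div_div_eq_mul_div, mul_comm _ (M : ℂ), mul_div_assoc]
  congr 4
  · push_cast
    field_simp
  · field_simp

/-- The left side is M times the index m/M lattice sum restricted to M ∣ c. Summing the characters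
over b imposes this restriction and supplies the factor M, while summing over a restores all rows.
-/
theorem appellCompletion_div_nat {M m : ℕ} (hM : M ≠ 0) (hm : 0 < m) (hMm : Nat.Coprime m M)
    {τ : ℂ} (hτ : 0 < τ.im) (z₁ z₂ : ℂ) :
    appellCompletion m (τ / M) (z₁ / M) (z₂ / M) =
      ∑ a ∈ Finset.range M, ∑ b ∈ Finset.range M, latticeSumMod M m τ z₁ z₂ a b := by
  have hμ : (0 : ℝ) < m / M := by
    have := Nat.pos_of_ne_zero hM
    positivity
  have hM' : (M : ℤ) ≠ 0 := by exact_mod_cast hM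
  have hs := summable_latticeTerm hμ hτ z₁ z₂
  have hs₁ : Summable fun x : ℤ × ℤ ↦ latticeTerm (m / M) τ z₁ z₂ x.1 (M * x.2) :=
    hs.comp_injective (i := fun x : ℤ × ℤ ↦ (x.1, (M : ℤ) * x.2)) fun x y h ↦ by
      simp only [Prod.mk.injEq, mul_right_inj' hM'] at h
      exact Prod.ext h.1 h.2
  have hs₂ : ∀ a : ℤ, Summable fun x : ℤ × ℤ ↦ latticeTerm (m / M) τ z₁ z₂ (a + M * x.1) x.2 :=
    fun a ↦ hs.comp_injective (i := fun x : ℤ × ℤ ↦ (a + (M : ℤ) * x.1, x.2)) fun x y h ↦ by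
      simp only [Prod.mk.injEq, add_right_inj, mul_right_inj' hM'] at h
      exact Prod.ext h.1 h.2
  have hs₃ : ∀ a b : ℤ, Summable fun x : ℤ × ℤ ↦
      e2 (-(m / M * b * x.2)) * latticeTerm (m / M) τ z₁ z₂ (a + M * x.1) x.2 := by
    intro a b
    refine Summable.of_norm_bounded (hs₂ a).norm fun x ↦ ?_
    have : (-(m / M * b * x.2) : ℂ).im = 0 := by
      rw [show (-(m / M * b * x.2) : ℂ) = ((-(m / M * b * x.2) : ℝ) : ℂ) by push_cast; rfl,
        Complex.ofReal_im]
    rw [norm_mul, norm_e2, this]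
    simp
  have hinner : ∀ a : ℤ, ∑ b ∈ Finset.range M, latticeSumMod M m τ z₁ z₂ a b =
      -1 / (2 * Real.pi * Complex.I) * (M * ∑' x : ℤ, ∑' c : ℤ,
        latticeTerm (m / M) τ z₁ z₂ (a + M * x) (M * c)) := by
    intro a
    simp only [latticeSumMod]
    rw [← Finset.mul_sum, ← Summable.tsum_finsetSum fun (b : ℕ) _ ↦ hs₃ a b]
    simp only [← Finset.sum_mul, sum_range_e2 hM hMm]
    congr 1
    have h0 : (fun x : ℤ × ℤ ↦ (if (M : ℤ) ∣ x.2 then (M : ℂ) else 0) *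
        latticeTerm (m / M) τ z₁ z₂ (a + M * x.1) x.2) = fun x : ℤ × ℤ ↦
        M * (if (M : ℤ) ∣ x.2 then latticeTerm (m / M) τ z₁ z₂ (a + M * x.1) x.2 else 0) := by
      ext x; split_ifs <;> simp
    have hs₄ : Summable fun x : ℤ × ℤ ↦
        (if (M : ℤ) ∣ x.2 then latticeTerm (m / M) τ z₁ z₂ (a + M * x.1) x.2 else 0) := by
      refine Summable.of_norm_bounded (hs₂ a).norm fun x ↦ ?_
      split_ifs
      · exact le_rfl
      · simp
    rw [h0, tsum_mul_left, hs₄.tsum_prod]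
    congr 1
    exact tsum_congr fun x ↦
      tsum_ite_dvd hM fun c ↦ latticeTerm (m / M) τ z₁ z₂ (a + M * x) c
  have hrows : Summable fun a : ℤ ↦ ∑' c : ℤ, latticeTerm (m / M) τ z₁ z₂ a (M * c) := hs₁.prod
  rw [Finset.sum_congr rfl fun (a : ℕ) _ ↦ hinner a, ← Finset.mul_sum, ← Finset.mul_sum,
    ← tsum_int_eq_sum_range_tsum (Nat.pos_of_ne_zero hM) hrows, appellCompletion]
  simp only [latticeTerm_div_nat hM m hτ, tsum_mul_left]
  rw [hs₁.tsum_prod]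

theorem sum_zmod_prod_eq_sum_range {M : ℕ} [NeZero M] {G : ℤ → ℤ → ℂ}
    (hG : ∀ a a' b b' : ℤ, (M : ℤ) ∣ a' - a → (M : ℤ) ∣ b' - b → G a b = G a' b')
    {a b : ZMod M × ZMod M → ℤ} (ha : ∀ p, (a p : ZMod M) = p.1)
    (hb : ∀ p, (b p : ZMod M) = p.2) :
    ∑ p, G (a p) (b p) = ∑ i ∈ Finset.range M, ∑ j ∈ Finset.range M, G i j := by
  have h1 : ∀ p, G (a p) (b p) = G (p.1.val : ℕ) (p.2.val : ℕ) := by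
    intro p
    refine hG _ _ _ _ ?_ ?_
    · rw [← ZMod.intCast_eq_intCast_iff_dvd_sub, ha]; simp
    · rw [← ZMod.intCast_eq_intCast_iff_dvd_sub, hb]; simp
  have h2 : ∀ g : ℕ → ℂ, ∑ x : ZMod M, g x.val = ∑ i ∈ Finset.range M, g i := by
    intro g
    obtain ⟨N, rfl⟩ := Nat.exists_eq_succ_of_ne_zero (NeZero.ne M)
    exact Fin.sum_univ_eq_sum_range g (N + 1)
  rw [Finset.sum_congr rfl fun p _ ↦ h1 p, Fintype.sum_prod_type,
    ← h2 fun i ↦ ∑ j ∈ Finset.range M, G i j]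
  exact Finset.sum_congr rfl fun x _ ↦ h2 fun j ↦ G (x.val : ℕ) j

theorem appellCompletion_div_nat_eq_sum {M m : ℕ} [NeZero M] (hm : 0 < m)
    (hMm : Nat.Coprime m M) {τ : ℂ} (hτ : 0 < τ.im) (z₁ z₂ : ℂ) {a b : ZMod M × ZMod M → ℤ}
    (ha : ∀ p, (a p : ZMod M) = p.1) (hb : ∀ p, (b p : ZMod M) = p.2) :
    appellCompletion m (τ / M) (z₁ / M) (z₂ / M) =
      ∑ p, latticeSumMod M m τ z₁ z₂ (a p) (b p) := by
  rw [appellCompletion_div_nat (NeZero.ne M) hm hMm hτ]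
  exact (sum_zmod_prod_eq_sum_range (fun _ _ _ _ h h' ↦
    latticeSumMod_congr (NeZero.ne M) m τ z₁ z₂ h h') ha hb).symm

/-! ### Transformation laws of `Φ̃` -/

theorem PhiRegular.add_int {τ z₁ z₂ : ℂ} (h : PhiRegular τ z₁ z₂) (N d₁ d₂ : ℤ) :
    PhiRegular (τ + N) (z₁ + d₁) (z₂ + d₂) := by
  refine fun p l ↦ ⟨fun h' ↦ (h (p + l * N - d₁) l).1 ?_, fun h' ↦ (h (p + l * N - d₂) l).2 ?_⟩ <;>
  · push_cast
    linear_combination h'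

theorem PhiRegular.neg_one_div {τ z₁ z₂ : ℂ} (hτ : τ ≠ 0) (h : PhiRegular τ z₁ z₂) :
    PhiRegular (-1 / τ) (z₁ / τ) (z₂ / τ) := by
  refine fun p l ↦ ⟨fun h' ↦ (h (-l) p).1 ?_, fun h' ↦ (h (-l) p).2 ?_⟩ <;>
  · rw [div_eq_iff hτ] at h'
    rw [h']
    push_cast
    field_simp
    ring

theorem PhiRegular.div_nat {M : ℕ} [NeZero M] {τ z₁ z₂ : ℂ} {a b : ZMod M × ZMod M → ℤ}
    (ha : ∀ p, (a p : ZMod M) = p.1) (hb : ∀ p, (b p : ZMod M) = p.2)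
    (h : ∀ p, PhiRegular (M * τ) (z₁ + a p * τ) (z₂ + b p * τ)) :
    PhiRegular (τ / M) (z₁ / M) (z₂ / M) := by
  have hM : (M : ℂ) ≠ 0 := by exact_mod_cast NeZero.ne M
  intro p l
  -- A pole of the left side at p + l(τ/M) would be a pole of the summand whose two indices are both
  -- congruent to -l.
  set x : ZMod M × ZMod M := (((-l : ℤ) : ZMod M), ((-l : ℤ) : ZMod M))
  obtain ⟨s, hs⟩ := (ZMod.intCast_eq_intCast_iff_dvd_sub (-l) (a x) M).1 (ha x).symm
  obtain ⟨t, ht⟩ := (ZMod.intCast_eq_intCast_iff_dvd_sub (-l) (b x) M).1 (hb x).symm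
  have hs' : (a x : ℂ) + l = M * s := by
    rw [← Int.cast_natCast M, ← Int.cast_mul, ← hs]; push_cast; ring
  have ht' : (b x : ℂ) + l = M * t := by
    rw [← Int.cast_natCast M, ← Int.cast_mul, ← ht]; push_cast; ring
  constructor
  · intro h'
    rw [div_eq_iff hM] at h'
    refine (h x (M * p) s).1 ?_
    rw [h']
    push_cast
    field_simp
    linear_combination τ * hs'
  · intro h'
    rw [div_eq_iff hM] at h'
    refine (h x (M * p) t).2 ?_
    rw [h']
    push_cast
    field_simp
    linear_combination τ * ht'

theorem PhiTilde_add_int {m : ℕ} (hm : 0 < m) {τ : ℂ} (hτ : 0 < τ.im) {z₁ z₂ : ℂ}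
    (h : PhiRegular τ z₁ z₂) (N d₁ d₂ : ℤ) :
    PhiTilde m 0 (τ + N) (z₁ + d₁) (z₂ + d₂) 0 = PhiTilde m 0 τ z₁ z₂ 0 := by
  have hτ' : 0 < (τ + N).im := by simpa using hτ
  have h1 := appellCompletion_add_int m (τ := τ) N (-d₂) (-d₁) (-z₂) (-z₁)
  push_cast at h1
  rw [PhiTilde_eq hm hτ' (h.add_int N d₁ d₂), PhiTilde_eq hm hτ h, appellCompletion_add_int,
    ← h1, neg_add, neg_add]

theorem PhiTilde_neg_one_div {m : ℕ} (hm : 0 < m) {τ : ℂ} (hτ : 0 < τ.im) {z₁ z₂ : ℂ}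
    (h : PhiRegular τ z₁ z₂) :
    PhiTilde m 0 (-1 / τ) (z₁ / τ) (z₂ / τ) 0 =
      τ * e2 (m * (z₁ * z₂ / τ)) * PhiTilde m 0 τ z₁ z₂ 0 := by
  have hτ0 : τ ≠ 0 := by rintro rfl; simp at hτ
  have hτ' : 0 < (-1 / τ).im := by
    rw [neg_div, one_div, Complex.neg_im, Complex.inv_im, neg_div, neg_neg]
    have := Complex.normSq_pos.2 hτ0
    positivity
  rw [PhiTilde_eq hm hτ' (h.neg_one_div hτ0), PhiTilde_eq hm hτ h, ← neg_div, ← neg_div,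
    appellCompletion_neg_one_div m hτ, appellCompletion_neg_one_div m hτ, neg_mul_neg,
    mul_comm z₂ z₁]
  ring

theorem PhiTilde_div_nat {M m : ℕ} [NeZero M] (hm : 0 < m) (hMm : Nat.Coprime m M)
    {τ : ℂ} (hτ : 0 < τ.im) {z₁ z₂ : ℂ} {a b : ZMod M × ZMod M → ℤ}
    (ha : ∀ p, (a p : ZMod M) = p.1) (hb : ∀ p, (b p : ZMod M) = p.2)
    (h : ∀ p, PhiRegular (M * τ) (z₁ + a p * τ) (z₂ + b p * τ)) :
    PhiTilde m 0 (τ / M) (z₁ / M) (z₂ / M) 0 =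
      ∑ p, e2 (m * a p * b p / M * τ + m / M * (b p * z₁ + a p * z₂)) *
        PhiTilde m 0 (M * τ) (z₁ + a p * τ) (z₂ + b p * τ) 0 := by
  have hM := NeZero.ne M
  have hM0 : (0 : ℝ) < M := by exact_mod_cast Nat.pos_of_ne_zero hM
  have hτ₁ : 0 < (τ / M).im := by rw [Complex.div_natCast_im]; positivity
  have hτ₂ : 0 < (M * τ).im := by
    rw [← Complex.ofReal_natCast, Complex.im_ofReal_mul]; positivity
  -- The second completion has arguments (-z₂, -z₁), so its term (-b, -a) must be matched with the
  -- term (a, b) of the first.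
  let e : ZMod M × ZMod M ≃ ZMod M × ZMod M :=
    (Equiv.prodComm _ _).trans ((Equiv.neg _).prodCongr (Equiv.neg _))
  have ha' : ∀ p, ((-b (e p) : ℤ) : ZMod M) = p.1 := fun p ↦ by simp [hb, e]
  have hb' : ∀ p, ((-a (e p) : ℤ) : ZMod M) = p.2 := fun p ↦ by simp [ha, e]
  rw [PhiTilde_eq hm hτ₁ (PhiRegular.div_nat ha hb h), ← neg_div, ← neg_div,
    appellCompletion_div_nat_eq_sum hm hMm hτ z₁ z₂ ha hb,
    appellCompletion_div_nat_eq_sum hm hMm hτ (-z₂) (-z₁) ha' hb',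
    e.sum_comp (fun p ↦ latticeSumMod M m τ (-z₂) (-z₁) (-b p) (-a p)),
    ← Finset.sum_sub_distrib]
  refine Finset.sum_congr rfl fun p _ ↦ ?_
  rw [latticeSumMod_eq hM m hτ, latticeSumMod_eq hM m hτ, PhiTilde_eq hm hτ₂ (h p), mul_sub]
  push_cast
  congr 3 <;> ring

/-! ### Half integers modulo `ℤ` -/

theorem half_zero : half 0 = 0 := by simp [half]

theorem half_one : half 1 = 1 / 2 := by simp [half, ZMod.val_one]

theorem eq_zero_or_one (x : ZMod 2) : x = 0 ∨ x = 1 := by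
  revert x; decide

theorem exists_half_add (x y : ZMod 2) : ∃ d : ℤ, half (x + y) = half x + half y + d := by
  have h : (1 + 1 : ZMod 2) = 0 := by decide
  rcases eq_zero_or_one x with rfl | rfl <;> rcases eq_zero_or_one y with rfl | rfl
  · exact ⟨0, by norm_num [half_zero]⟩
  · exact ⟨0, by norm_num [half_zero, half_one]⟩
  · exact ⟨0, by norm_num [half_zero, half_one]⟩
  · exact ⟨-1, by rw [h, half_zero, half_one]; norm_num⟩

theorem exists_two_mul_half (x : ZMod 2) : ∃ d : ℤ, 2 * half x = d := by
  rcases eq_zero_or_one x with rfl | rfl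
  · exact ⟨0, by norm_num [half_zero]⟩
  · exact ⟨1, by norm_num [half_one]⟩

theorem half_one_sub (x : ZMod 2) : half (1 - x) = 1 / 2 - half x := by
  rcases eq_zero_or_one x with rfl | rfl
  · norm_num [half_zero, half_one]
  · norm_num [half_zero, half_one]

/-! ### Transformation laws of `f` -/

theorem f_add_one_of_zero {M n : ℕ} [NeZero M] (hn : 0 < n) (ε ε' σ : ZMod 2) {j k : ℝ}
    (hj : ∃ x : ℤ, j = half ε' + x) (hk : ∃ y : ℤ, k = half ε' + y) {τ z : ℂ} (hτ : 0 < τ.im)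
    (h : FRegular M (ε + ε') σ 0 j k τ z) :
    f M n ε σ 0 j k (τ + 1) z =
      Complex.exp (2 * Real.pi * Complex.I * n / M * (j * k)) * f M n (ε + ε') σ 0 j k τ z := by
  have hM : (M : ℂ) ≠ 0 := by exact_mod_cast NeZero.ne M
  have hM0 : (0 : ℝ) < M := by exact_mod_cast Nat.pos_of_ne_zero (NeZero.ne M)
  have hτM : 0 < (M * τ).im := by
    rw [← Complex.ofReal_natCast, Complex.im_ofReal_mul]; positivity
  obtain ⟨x, rfl⟩ := hj
  obtain ⟨y, rfl⟩ := hk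
  obtain ⟨d, hd⟩ := exists_half_add ε ε'
  have hd' : (half (ε + ε') : ℂ) = half ε + half ε' + d := by exact_mod_cast congrArg ((↑) : ℝ → ℂ) hd
  have key := PhiTilde_add_int hn hτM h M (x - d) (y - d)
  have e1 : (M * τ + (M : ℤ) : ℂ) = M * (τ + 1) := by push_cast; ring
  have e2' : (z + half σ + half 0 * τ) / 2 + (half ε' + x : ℝ) * τ + half (ε + ε') +
      ((x - d : ℤ) : ℂ) = (z + half σ + half 0 * (τ + 1)) / 2 + (half ε' + x : ℝ) * (τ + 1) +
        half ε := by
    rw [hd', half_zero]; push_cast; ring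
  have e3 : (z - half σ - half 0 * τ) / 2 + (half ε' + y : ℝ) * τ + half (ε + ε') +
      ((y - d : ℤ) : ℂ) = (z - half σ - half 0 * (τ + 1)) / 2 + (half ε' + y : ℝ) * (τ + 1) +
        half ε := by
    rw [hd', half_zero]; push_cast; ring
  rw [e1, e2', e3] at key
  simp only [f, PsiTilde, zero_div, key, ← mul_assoc]
  congr 1
  simp only [half_zero, e2, ← Complex.exp_add]
  congr 1
  push_cast
  ring

theorem f_add_one_of_one {M n : ℕ} [NeZero M] (hn : 0 < n) (ε ε' σ : ZMod 2) {j k : ℝ}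
    (hj : ∃ x : ℤ, j = half ε' + x) (hk : ∃ y : ℤ, k = half ε' + y) {τ z : ℂ} (hτ : 0 < τ.im)
    (h : FRegular M (ε + ε' - σ) (1 - σ) 1 j k τ z) :
    f M n ε σ 1 j k (τ + 1) z =
      Complex.exp (2 * Real.pi * Complex.I * n / M * (j * k - 1 / 16)) *
        Complex.exp (2 * Real.pi * Complex.I * n * half σ / M * (k - j)) *
          f M n (ε + ε' - σ) (1 - σ) 1 j k τ z := by
  have hM : (M : ℂ) ≠ 0 := by exact_mod_cast NeZero.ne M
  have hM0 : (0 : ℝ) < M := by exact_mod_cast Nat.pos_of_ne_zero (NeZero.ne M)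
  have hτM : 0 < (M * τ).im := by
    rw [← Complex.ofReal_natCast, Complex.im_ofReal_mul]; positivity
  obtain ⟨x, rfl⟩ := hj
  obtain ⟨y, rfl⟩ := hk
  obtain ⟨d, hd⟩ := exists_half_add ε ε'
  obtain ⟨d₁, hd₁⟩ := exists_half_add (ε + ε' - σ) σ
  rw [sub_add_cancel, hd] at hd₁
  obtain ⟨d₂, hd₂⟩ := exists_two_mul_half σ
  have h₁ : (half (ε + ε' - σ) : ℂ) = half ε + half ε' + d - half σ - d₁ := by
    have : half (ε + ε' - σ) = half ε + half ε' + d - half σ - d₁ := by linarith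
    exact_mod_cast congrArg ((↑) : ℝ → ℂ) this
  have h₂ : 2 * (half σ : ℂ) = d₂ := by exact_mod_cast congrArg ((↑) : ℝ → ℂ) hd₂
  -- Replacing σ by 1/2 - σ moves the two arguments by σ in opposite directions. The change of ε by
  -- -σ corrects z₂, leaving the integer 2σ = d₂ in z₁.
  have key := PhiTilde_add_int hn hτM h M (x - d + d₁ + d₂) (y - d + d₁)
  have e1 : (M * τ + (M : ℤ) : ℂ) = M * (τ + 1) := by push_cast; ring
  have e2' : (z + half (1 - σ) + half 1 * τ) / 2 + (half ε' + x : ℝ) * τ + half (ε + ε' - σ) +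
      ((x - d + d₁ + d₂ : ℤ) : ℂ) =
      (z + half σ + half 1 * (τ + 1)) / 2 + (half ε' + x : ℝ) * (τ + 1) + half ε := by
    rw [h₁, half_one, half_one_sub]; push_cast; linear_combination -h₂
  have e3 : (z - half (1 - σ) - half 1 * τ) / 2 + (half ε' + y : ℝ) * τ + half (ε + ε' - σ) +
      ((y - d + d₁ : ℤ) : ℂ) =
      (z - half σ - half 1 * (τ + 1)) / 2 + (half ε' + y : ℝ) * (τ + 1) + half ε := by
    rw [h₁, half_one, half_one_sub]; push_cast; ring
  rw [e1, e2', e3] at key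
  simp only [f, PsiTilde, zero_div, key, ← mul_assoc]
  congr 1
  simp only [half_one, half_one_sub, e2, ← Complex.exp_add]
  congr 1
  push_cast
  field_simp
  ring

theorem f_neg_one_div {M n : ℕ} [NeZero M] (hn : 0 < n) (hMn : Nat.Coprime n M)
    (ε ε' σ σ' : ZMod 2) {j k : ℝ} (hj : ∃ x : ℤ, j = half ε' + x)
    (hk : ∃ y : ℤ, k = half ε' + y) {τ z : ℂ} (hτ : 0 < τ.im)
    {a b : ZMod M × ZMod M → ℤ} (ha : ∀ p, (a p : ZMod M) = p.1)
    (hb : ∀ p, (b p : ZMod M) = p.2)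
    (h : ∀ p, FRegular M (ε' + σ') σ' σ (half ε + a p) (half ε + b p) τ z) :
    f M n ε σ σ' j k (-1 / τ) (z / τ) =
      τ / M * Complex.exp (Real.pi * Complex.I * n / (2 * M * τ) * z ^ 2) *
        Complex.exp (Real.pi * Complex.I * n / M * (half σ * half σ')) *
        ∑ p : ZMod M × ZMod M,
          Complex.exp (-(2 * Real.pi * Complex.I * n / M) *
              ((half ε + a p) * k + (half ε + b p) * j) +
            2 * Real.pi * Complex.I * n / M * half σ' *
              ((half ε + a p) - (half ε + b p))) *
          f M n (ε' + σ') σ' σ (half ε + a p) (half ε + b p) τ z := by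
  have hτ0 : τ ≠ 0 := by rintro rfl; simp at hτ
  have hM : (M : ℂ) ≠ 0 := by exact_mod_cast NeZero.ne M
  have hM0 : (0 : ℝ) < M := by exact_mod_cast Nat.pos_of_ne_zero (NeZero.ne M)
  have hτ₁ : 0 < (τ / M).im := by rw [Complex.div_natCast_im]; positivity
  have hτ₂ : 0 < (M * τ).im := by
    rw [← Complex.ofReal_natCast, Complex.im_ofReal_mul]; positivity
  obtain ⟨x, rfl⟩ := hj
  obtain ⟨y, rfl⟩ := hk
  obtain ⟨d, hd⟩ := exists_half_add ε' σ'
  obtain ⟨d₁, hd₁⟩ := exists_two_mul_half ε'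
  obtain ⟨d₂, hd₂⟩ := exists_two_mul_half σ'
  have hd' : (half (ε' + σ') : ℂ) = half ε' + half σ' + d := by exact_mod_cast congrArg ((↑) : ℝ → ℂ) hd
  have h₁ : 2 * (half ε' : ℂ) = d₁ := by exact_mod_cast congrArg ((↑) : ℝ → ℂ) hd₁
  have h₂ : 2 * (half σ' : ℂ) = d₂ := by exact_mod_cast congrArg ((↑) : ℝ → ℂ) hd₂
  -- ζ₁ and ζ₂ are τ times the arguments of `PhiTilde` on the left side. Up to integers, they are
  -- also the arguments on the right side with the shifts a p · τ and b p · τ removed.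
  set ζ₁ : ℂ := (z + half σ * τ - half σ') / 2 - (half ε' + x) + half ε * τ with hζ₁
  set ζ₂ : ℂ := (z - half σ * τ + half σ') / 2 - (half ε' + y) + half ε * τ with hζ₂
  have c₁ : ∀ p, (z + half σ' + half σ * τ) / 2 + (half ε + a p : ℝ) * τ + half (ε' + σ') =
      ζ₁ + a p * τ + ((d + d₁ + d₂ + x : ℤ) : ℂ) := by
    intro p
    rw [hd', hζ₁]; push_cast; linear_combination h₁ + h₂
  have c₂ : ∀ p, (z - half σ' - half σ * τ) / 2 + (half ε + b p : ℝ) * τ + half (ε' + σ') =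
      ζ₂ + b p * τ + ((d + d₁ + y : ℤ) : ℂ) := by
    intro p
    rw [hd', hζ₂]; push_cast; linear_combination h₁
  have hreg : ∀ p, PhiRegular (M * τ) (ζ₁ + a p * τ) (ζ₂ + b p * τ) := by
    intro p
    have := (h p).add_int 0 (-(d + d₁ + d₂ + x)) (-(d + d₁ + y))
    rw [c₁, c₂] at this
    simpa only [Int.cast_zero, add_zero, Int.cast_neg, add_neg_cancel_right] using this
  have hf : ∀ p, f M n (ε' + σ') σ' σ (half ε + a p) (half ε + b p) τ z =
      e2 (-(n / (4 * M)) * (half σ : ℂ) ^ 2 * τ) *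
        (e2 (n * (half ε + a p : ℝ) * (half ε + b p : ℝ) / M * τ) *
        e2 (n / M * ((half ε + b p : ℝ) * ((z + half σ' + half σ * τ) / 2) +
          (half ε + a p : ℝ) * ((z - half σ' - half σ * τ) / 2))) *
        PhiTilde n 0 (M * τ) (ζ₁ + a p * τ) (ζ₂ + b p * τ) 0) := by
    intro p
    have := PhiTilde_add_int hn hτ₂ (hreg p) 0 (d + d₁ + d₂ + x) (d + d₁ + y)
    rw [Int.cast_zero, add_zero] at this
    rw [f, PsiTilde, zero_div, c₁, c₂, this]
  -- Inversion is applied at τ/M, since -1/(τ/M) = M · (-1/τ) is the modulus in `f` at -1/τ. The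
  -- distribution relation then expands the value at τ/M.
  have hdist := PhiTilde_neg_one_div hn hτ₁ (PhiRegular.div_nat ha hb hreg)
  rw [PhiTilde_div_nat hn hMn hτ ha hb hreg] at hdist
  have g₁ : -1 / (τ / M) = M * (-1 / τ) := by field_simp
  have g₂ : ζ₁ / M / (τ / M) = (z / τ + half σ + half σ' * (-1 / τ)) / 2 +
      (half ε' + x : ℝ) * (-1 / τ) + half ε := by
    rw [hζ₁]; push_cast; field_simp; ring
  have g₃ : ζ₂ / M / (τ / M) = (z / τ - half σ - half σ' * (-1 / τ)) / 2 +
      (half ε' + y : ℝ) * (-1 / τ) + half ε := by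
    rw [hζ₂]; push_cast; field_simp; ring
  rw [g₁, g₂, g₃] at hdist
  rw [f, PsiTilde, zero_div, hdist, Finset.mul_sum, Finset.mul_sum, Finset.mul_sum,
    Finset.mul_sum]
  refine Finset.sum_congr rfl fun p _ ↦ ?_
  rw [hf]
  -- Once the common factors τ/M and the value of `PhiTilde` are set aside, both sides are products
  -- of exponentials, so only exponents have to be compared.
  have hfin : ∀ u v w s t P A B C D E F : ℂ, u * v * w * s * t = A * B * C * D * E * F →
      ∀ Q : ℂ, u * (v * w * (P * s * (t * Q))) = P * A * B * (C * (D * (E * F * Q))) := by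
    intro u v w s t P A B C D E F h Q
    linear_combination P * Q * h
  refine hfin _ _ _ _ _ _ _ _ _ _ _ _ ?_ _
  simp only [e2, ← Complex.exp_add]
  congr 1
  rw [hζ₁, hζ₂]
  push_cast
  field_simp
  ring

end KacWakimoto

/-! ### The main theorem -/

theorem proposition4p6 (M n : ℕ) [NeZero M] (hM : Odd M) (hn : 0 < n) (hMn : Nat.Coprime n M)
    (ε ε' σ : ZMod 2) (j k : ℝ)
    (hj : ∃ x : ℤ, j = KacWakimoto.half ε' + x) (hk : ∃ y : ℤ, k = KacWakimoto.half ε' + y)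
    (τ z : ℂ) (hτ : 0 < τ.im) :
    -- (a): `a p`, `b p` are arbitrary representatives of the two components of `p ∈ (ℤ/Mℤ)²`
    (∀ (σ' : ZMod 2) (a b : ZMod M × ZMod M → ℤ),
      (∀ p, (a p : ZMod M) = p.1) → (∀ p, (b p : ZMod M) = p.2) →
      (∀ p, KacWakimoto.FRegular M (ε' + σ') σ' σ
        (KacWakimoto.half ε + a p) (KacWakimoto.half ε + b p) τ z) →
      KacWakimoto.f M n ε σ σ' j k (-1 / τ) (z / τ) =
        τ / M * Complex.exp (Real.pi * Complex.I * n / (2 * M * τ) * z ^ 2) *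
          Complex.exp (Real.pi * Complex.I * n / M *
            (KacWakimoto.half σ * KacWakimoto.half σ')) *
          ∑ p : ZMod M × ZMod M,
            Complex.exp (-(2 * Real.pi * Complex.I * n / M) *
                ((KacWakimoto.half ε + a p) * k + (KacWakimoto.half ε + b p) * j) +
              2 * Real.pi * Complex.I * n / M * KacWakimoto.half σ' *
                ((KacWakimoto.half ε + a p) - (KacWakimoto.half ε + b p))) *
            KacWakimoto.f M n (ε' + σ') σ' σ
              (KacWakimoto.half ε + a p) (KacWakimoto.half ε + b p) τ z) ∧
    -- (b), `σ' = 0`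
    (KacWakimoto.FRegular M (ε + ε') σ 0 j k τ z →
      KacWakimoto.f M n ε σ 0 j k (τ + 1) z =
        Complex.exp (2 * Real.pi * Complex.I * n / M * (j * k)) *
          KacWakimoto.f M n (ε + ε') σ 0 j k τ z) ∧
    -- (b), `σ' = 1/2`
    (KacWakimoto.FRegular M (ε + ε' - σ) (1 - σ) 1 j k τ z →
      KacWakimoto.f M n ε σ 1 j k (τ + 1) z =
        Complex.exp (2 * Real.pi * Complex.I * n / M * (j * k - 1 / 16)) *
          Complex.exp (2 * Real.pi * Complex.I * n * KacWakimoto.half σ / M * (k - j)) *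
          KacWakimoto.f M n (ε + ε' - σ) (1 - σ) 1 j k τ z) := by 
  refine ⟨fun σ' a b ha hb h ↦ ?_, fun h ↦ ?_, fun h ↦ ?_⟩
  · exact KacWakimoto.f_neg_one_div hn hMn ε ε' σ σ' hj hk hτ ha hb (by exact_mod_cast h)
  · exact KacWakimoto.f_add_one_of_zero hn ε ε' σ hj hk hτ h
  · exact KacWakimoto.f_add_one_of_one hn ε ε' σ hj hk hτ h
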